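/- An MV-algebra is a structure $(A,\oplus,{}^*,0)$ such that $(A,\oplus,0)$ is an abelian monoid and, for all $x,y\in A$, $(x^*)^*=x$, $0^*\oplus x=0^*$ and $(x^*\oplus y)^*\oplus y=(y^*\oplus x)^*\oplus x$; put $1=0^*$ and $x\odot y=(x^*\oplus y^*)^*$. The standard MV-algebra is the real interval $[0,1]$ with $x\oplus y=\min(1,x+y)$ and $x^*=1-x$. A Riesz MV-algebra is an MV-algebra $R$ with an operation $[0,1]\times R\to R$, $(r,x)\mapsto rx$, such that for all $r,q\in[0,1]$ and $x,y\in R$: $r(x\odot y^*)=(rx)\odot(ry)^*$, $(r\odot q^*)x=(rx)\odot(qx)^*$, $r(qx)=(rq)x$ (where $rq$ is the product of real numbers) and $1x=x$. The standard MV-algebra $[0,1]$ with multiplication of real numbers is the standard Riesz MV-algebra. Formulas of $\infty$-valued Łukasiewicz logic $\mathcal L_\infty$ are built from propositional variables $v_1,v_2,\dots$ with $\neg$ and $\to$; formulas of $\mathbb R\mathcal L$ are built from the same variables with $\neg$, $\to$ and a unary connective $\nabla_r$ for each $r\in[0,1]$. Write $\varphi\vee\psi=(\varphi\to\psi)\to\psi$,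 $\varphi\wedge\psi=\neg(\neg\varphi\vee\neg\psi)$ and $\varphi\leftrightarrow\psi=(\varphi\to\psi)\wedge(\psi\to\varphi)$. The axioms of $\mathcal L_\infty$ are all formulas $\varphi\to(\psi\to\varphi)$, $(\varphi\to\psi)\to((\psi\to\chi)\to(\varphi\to\chi))$, $((\varphi\to\psi)\to\psi)\to((\psi\to\varphi)\to\varphi)$ and $(\neg\varphi\to\neg\psi)\to(\psi\to\varphi)$, where $\varphi,\psi,\chi$ are formulas of $\mathcal L_\infty$. The axioms of $\mathbb R\mathcal L$ are all formulas of these four forms with $\varphi,\psi,\chi$ formulas of $\mathbb R\mathcal L$, and in addition, for $r,q\in[0,1]$ and $\varphi,\psi$ formulas of $\mathbb R\mathcal L$, the formulas $\nabla_r(\varphi\to\psi)\leftrightarrow(\nabla_r\varphi\to\nabla_r\psi)$, $\nabla_{r\odot q^*}\varphi\leftrightarrow(\nabla_q\varphi\to\nabla_r\varphi)$, $\nabla_r\nabla_q\varphi\leftrightarrow\nabla_{rq}\varphi$ and $\nabla_1\varphi\leftrightarrow\varphi$. In each of the two systems a formula is provable if it can be derived from the axioms by modus ponens. An evaluation into a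 Riesz MV-algebra $R$ is a function $e$ from the formulas of $\mathbb R\mathcal L$ to $R$ with $e(\varphi\to\psi)=e(\varphi)^*\oplus e(\psi)$, $e(\neg\varphi)=e(\varphi)^*$ and $e(\nabla_r\varphi)=(r\,e(\varphi)^*)^*$ for all formulas $\varphi,\psi$ and all $r\in[0,1]$. **Theorem.** For every formula $\varphi$ of $\mathbb R\mathcal L$ the following are equivalent: (i) $\varphi$ is provable in $\mathbb R\mathcal L$; (ii) $e(\varphi)=1$ for every Riesz MV-algebra $R$ and every evaluation $e$ into $R$; (iii) $e(\varphi)=1$ for every evaluation $e$ into the standard Riesz MV-algebra $[0,1]$. Moreover, $\mathbb R\mathcal L$ is a conservative extension of $\mathcal L_\infty$: a formula of $\mathcal L_\infty$ is provable in $\mathcal L_\infty$ if and only if it is provable in $\mathbb R\mathcal L$. -/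

import Mathlib

universe u

namespace RieszMV

/-- An MV-algebra `(A, ⊕, *, 0)`. -/
class MVAlgebra (A : Type u) where
  oplus : A → A → A
  star : A → A
  zero : A
  oplus_assoc : ∀ x y z : A, oplus (oplus x y) z = oplus x (oplus y z)
  oplus_comm : ∀ x y : A, oplus x y = oplus y x
  zero_oplus : ∀ x : A, oplus zero x = x
  star_star : ∀ x : A, star (star x) = x
  star_zero_oplus : ∀ x : A, oplus (star zero) x = star zero
  luk : ∀ x y : A,
    oplus (star (oplus (star x) y)) y = oplus (star (oplus (star y) x)) x

namespace MVAlgebra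

/-- The unit `1 = 0*`. -/
def one {A : Type u} [MVAlgebra A] : A := star zero

/-- `x ⊙ y = (x* ⊕ y*)*`. -/
def odot {A : Type u} [MVAlgebra A] (x y : A) : A := star (oplus (star x) (star y))

end MVAlgebra

open MVAlgebra

/-- The standard MV-algebra: the real interval `[0,1]` with `x ⊕ y = min (1, x + y)` and
`x* = 1 - x`. -/
noncomputable instance instMVAlgebraUnitInterval : MVAlgebra unitInterval where
  oplus x y := ⟨min 1 ((x : ℝ) + y),
    le_min zero_le_one (add_nonneg x.2.1 y.2.1), min_le_left _ _⟩
  star x := ⟨1 - (x : ℝ), sub_nonneg.2 x.2.2, sub_le_self _ x.2.1⟩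
  zero := 0
  oplus_assoc x y z := by
    apply Subtype.ext
    have hx := x.2.1
    have hy := y.2.1
    have hz := z.2.1
    simp only [min_def]
    split_ifs <;> linarith
  oplus_comm x y := by
    apply Subtype.ext
    simp only [add_comm]
  zero_oplus x := by
    apply Subtype.ext
    have hx := x.2.2
    simp [hx]
  star_star x := by
    apply Subtype.ext
    simp
  star_zero_oplus x := by
    apply Subtype.ext
    have hx := x.2.1
    simp [hx]
  luk x y := by
    apply Subtype.ext
    have hx := x.2
    have hy := y.2
    simp only [Set.mem_Icc] at hx hy
    simp only [min_def]
    split_ifs <;> linarith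

/-- A Riesz MV-algebra: an MV-algebra `R` with a scalar multiplication `[0,1] × R → R`.
In `smul_odot_star` and `odot_star_smul` the operations on scalars are those of the standard
MV-algebra `[0,1]`, and in `smul_smul` the product `r * q` is that of real numbers. -/
class RieszMVAlgebra (R : Type u) extends MVAlgebra R where
  smul : unitInterval → R → R
  smul_odot_star : ∀ (r : unitInterval) (x y : R),
    smul r (odot x (star y)) = odot (smul r x) (star (smul r y))
  odot_star_smul : ∀ (r q : unitInterval) (x : R),
    smul (MVAlgebra.odot r (MVAlgebra.star q)) x = odot (smul r x) (star (smul q x))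
  smul_smul : ∀ (r q : unitInterval) (x : R), smul r (smul q x) = smul (r * q) x
  one_smul : ∀ x : R, smul 1 x = x

theorem coe_odot_star (x y : unitInterval) :
    ((odot x (star y) : unitInterval) : ℝ) = max 0 ((x : ℝ) - y) := by
  change 1 - min 1 ((1 - (x : ℝ)) + (1 - (1 - (y : ℝ)))) = _
  simp only [min_def, max_def]
  split_ifs <;> linarith

/-- The standard Riesz MV-algebra: the standard MV-algebra `[0,1]` with the product of reals. -/
noncomputable instance instRieszMVAlgebraUnitInterval : RieszMVAlgebra unitInterval where
  smul r x := r * x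
  smul_odot_star r x y := by
    apply Subtype.ext
    rw [Set.Icc.coe_mul, coe_odot_star, coe_odot_star, Set.Icc.coe_mul, Set.Icc.coe_mul,
      mul_max_of_nonneg _ _ r.2.1]
    ring_nf
  odot_star_smul r q x := by
    apply Subtype.ext
    rw [Set.Icc.coe_mul, coe_odot_star, coe_odot_star, Set.Icc.coe_mul, Set.Icc.coe_mul,
      max_mul_of_nonneg _ _ x.2.1]
    ring_nf
  smul_smul r q x := (mul_assoc r q x).symm
  one_smul x := one_mul x

/-- Formulas of the `∞`-valued Łukasiewicz propositional logic, with primitive connectives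
`¬` and `→` and countably many propositional variables. -/
inductive LForm : Type
  | var : ℕ → LForm
  | neg : LForm → LForm
  | imp : LForm → LForm → LForm

namespace LForm

/-- Axioms of the `∞`-valued Łukasiewicz logic. -/
inductive IsAxiom : LForm → Prop
  | a1 (φ ψ : LForm) : IsAxiom (φ.imp (ψ.imp φ))
  | a2 (φ ψ χ : LForm) : IsAxiom ((φ.imp ψ).imp ((ψ.imp χ).imp (φ.imp χ)))
  | a3 (φ ψ : LForm) : IsAxiom (((φ.imp ψ).imp ψ).imp ((ψ.imp φ).imp φ))
  | a4 (φ ψ : LForm) : IsAxiom ((φ.neg.imp ψ.neg).imp (ψ.imp φ))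

/-- Provability in Łukasiewicz logic: derivability from the axioms by modus ponens. -/
inductive Provable : LForm → Prop
  | ax {φ : LForm} : IsAxiom φ → Provable φ
  | mp {φ ψ : LForm} : Provable (φ.imp ψ) → Provable φ → Provable ψ

end LForm

/-- Formulas of `ℝℒ`: the language of Łukasiewicz logic together with unary connectives
`∇ᵣ` for `r ∈ [0,1]`. -/
inductive RForm : Type
  | var : ℕ → RForm
  | neg : RForm → RForm
  | imp : RForm → RForm → RForm
  | nabla : unitInterval → RForm → RForm

namespace RForm

/-- `φ ∨ ψ = (φ → ψ) → ψ`. -/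
def or (φ ψ : RForm) : RForm := (φ.imp ψ).imp ψ

/-- `φ ∧ ψ = ¬(¬φ ∨ ¬ψ)`. -/
def and (φ ψ : RForm) : RForm := (φ.neg.or ψ.neg).neg

/-- `φ ↔ ψ = (φ → ψ) ∧ (ψ → φ)`. -/
def iff (φ ψ : RForm) : RForm := (φ.imp ψ).and (ψ.imp φ)

/-- Axioms of `ℝℒ`: the Łukasiewicz axiom schemes `a1`-`a4`, for formulas of `ℝℒ`, and the
schemes `rl1`-`rl4` for the connectives `∇ᵣ`. -/
inductive IsAxiom : RForm → Prop
  | a1 (φ ψ : RForm) : IsAxiom (φ.imp (ψ.imp φ))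
  | a2 (φ ψ χ : RForm) : IsAxiom ((φ.imp ψ).imp ((ψ.imp χ).imp (φ.imp χ)))
  | a3 (φ ψ : RForm) : IsAxiom (((φ.imp ψ).imp ψ).imp ((ψ.imp φ).imp φ))
  | a4 (φ ψ : RForm) : IsAxiom ((φ.neg.imp ψ.neg).imp (ψ.imp φ))
  | rl1 (r : unitInterval) (φ ψ : RForm) :
      IsAxiom ((nabla r (φ.imp ψ)).iff ((nabla r φ).imp (nabla r ψ)))
  | rl2 (r q : unitInterval) (φ : RForm) :
      IsAxiom ((nabla (odot r (star q)) φ).iff ((nabla q φ).imp (nabla r φ)))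
  | rl3 (r q : unitInterval) (φ : RForm) :
      IsAxiom ((nabla r (nabla q φ)).iff (nabla (r * q) φ))
  | rl4 (φ : RForm) : IsAxiom ((nabla 1 φ).iff φ)

/-- Provability in `ℝℒ`: derivability from the axioms by modus ponens. -/
inductive Provable : RForm → Prop
  | ax {φ : RForm} : IsAxiom φ → Provable φ
  | mp {φ ψ : RForm} : Provable (φ.imp ψ) → Provable φ → Provable ψ

end RForm

/-- A formula of Łukasiewicz logic, regarded as a formula of `ℝℒ`. -/
def LForm.toRForm : LForm → RForm
  | LForm.var n => RForm.var n
  | LForm.neg φ => RForm.neg φ.toRForm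
  | LForm.imp φ ψ => RForm.imp φ.toRForm ψ.toRForm

/-- Evaluations of the formulas of `ℝℒ` into a Riesz MV-algebra. -/
structure IsEvaluation {R : Type u} [RieszMVAlgebra R] (e : RForm → R) : Prop where
  map_imp : ∀ φ ψ : RForm, e (φ.imp ψ) = oplus (star (e φ)) (e ψ)
  map_neg : ∀ φ : RForm, e φ.neg = star (e φ)
  map_nabla : ∀ (r : unitInterval) (φ : RForm),
    e (RForm.nabla r φ) = star (RieszMVAlgebra.smul r (star (e φ)))

end RieszMV

/-! Soundness is a computation, so the content is that an unprovable formula fails in $[0,1]$.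
Prelinearity and Zorn's lemma give a linear theory omitting the formula (`IsTheory.exists_linear`),
whose Lindenbaum algebra is an MV-chain where the formula lies below 1 (`IsTheory.exists_chain`). By
Chang's construction this chain is the unit interval of a totally ordered abelian group with a unit
(`ChangGroup`), and the connectives become minima, sums and differences in that group. The given
evaluation therefore selects one linear piece of the formula: finitely many linear inequalities hold
at the values of the variables, and wherever they hold the formula is a fixed linear form
(`Tracks`). Its failure is a finite linear system with some strict inequalities. Fourier–Motzkin
elimination (`exists_real_solution`) solves that system in the reals, and dividing by the value of
the unit gives a refuting valuation in $[0,1]$.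

With integer coefficients this is Chang's completeness theorem. For ℝℒ two facts are added. The
axioms for ∇ make every theory compatible with ∇, so the chain carries a Riesz structure
(`RForm.exists_evaluation_ne_one`). Scalar multiplication preserves sums without overflow in both
arguments, so it extends to a real module structure on Chang's group, and the same elimination runs
with real coefficients. Conservativity follows: soundness of ℝℒ in $[0,1]$ is combined with the
integer case. -/

namespace RieszMV
open MVAlgebra

/-! ### Order and residuation in MV-algebras -/

namespace MVAlgebra

local infixl:65 " ⊹ " => oplus
local prefix:max "∼" => star

variable {A : Type*} [MVAlgebra A]

theorem star_one : star (one : A) = zero := star_star _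

theorem star_injective {x y : A} (h : ∼x = ∼y) : x = y := by
  rw [← star_star x, h, star_star]

theorem oplus_zero (x : A) : x ⊹ zero = x := by rw [oplus_comm, zero_oplus]

theorem one_oplus (x : A) : one ⊹ x = one := star_zero_oplus x

theorem oplus_one (x : A) : x ⊹ one = one := by rw [oplus_comm, one_oplus]

theorem star_oplus_self (x : A) : ∼x ⊹ x = one := by
  have h := luk x one
  rw [oplus_one, star_one, zero_oplus] at h
  exact h.symm

theorem oplus_star_self (x : A) : x ⊹ ∼x = one := by rw [oplus_comm, star_oplus_self]

theorem oplus_left_comm (x y z : A) : x ⊹ (y ⊹ z) = y ⊹ (x ⊹ z) := by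
  rw [← oplus_assoc, oplus_comm x y, oplus_assoc]

/-- The natural order of an MV-algebra. -/
def Le (x y : A) : Prop := ∼x ⊹ y = one

theorem Le.antisymm {x y : A} (h : Le x y) (h' : Le y x) : x = y := by
  have e := luk x y
  rw [h, h', star_one, zero_oplus, zero_oplus] at e
  exact e.symm

theorem Le.eq_oplus {x y : A} (h : Le x y) : x ⊹ ∼(x ⊹ ∼y) = y := by
  have e := luk x y
  rw [h, star_one, zero_oplus] at e
  rw [oplus_comm, oplus_comm x, ← e]

theorem le_oplus_right (x y : A) : Le x (x ⊹ y) := by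
  rw [Le, ← oplus_assoc, star_oplus_self, one_oplus]

theorem Le.refl (x : A) : Le x x := star_oplus_self x

theorem Le.oplus_right {x y : A} (h : Le x y) (z : A) : Le (x ⊹ z) (y ⊹ z) := by
  have e : y ⊹ z = x ⊹ z ⊹ ∼(x ⊹ ∼y) := by
    conv_lhs => rw [← h.eq_oplus]
    rw [oplus_assoc, oplus_assoc, oplus_comm z]
  rw [e]
  exact le_oplus_right _ _

theorem Le.oplus_left {x y : A} (h : Le x y) (z : A) : Le (z ⊹ x) (z ⊹ y) := by
  rw [oplus_comm z, oplus_comm z]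
  exact h.oplus_right z

theorem le_star_comm {x y : A} : Le (∼x) y ↔ Le (∼y) x := by
  rw [Le, Le, star_star, star_star, oplus_comm]

theorem Le.star {x y : A} (h : Le x y) : Le (∼y) (∼x) := by
  rw [le_star_comm, star_star]
  exact h

theorem zero_le (x : A) : Le zero x := star_zero_oplus x

theorem eq_one_of_one_le {x : A} (h : Le one x) : x = one := by
  rw [← h.eq_oplus, one_oplus]

theorem eq_zero_of_le_zero {x : A} (h : Le x zero) : x = zero := h.antisymm (zero_le x)

theorem odot_comm (x y : A) : odot x y = odot y x := by
  rw [odot, odot, oplus_comm]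

theorem odot_assoc (x y z : A) : odot (odot x y) z = odot x (odot y z) := by
  simp only [odot, star_star, oplus_assoc]

theorem star_odot (x y : A) : ∼(odot x y) = ∼x ⊹ ∼y := star_star _

theorem odot_le_left (x y : A) : Le (odot x y) x := by
  rw [odot, le_star_comm]
  exact le_oplus_right _ _

theorem Le.odot_left {x y : A} (h : Le x y) (z : A) : Le (odot z x) (odot z y) :=
  (h.star.oplus_left _).star

/-- The adjunction between `⊙` and `→`. -/
theorem odot_le_iff {x y z : A} : Le (odot x y) z ↔ Le x (∼y ⊹ z) := by
  rw [Le, Le, star_odot, oplus_assoc]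

theorem odot_star_eq_zero_iff {x y : A} : odot x (∼y) = zero ↔ Le x y := by
  rw [odot, star_star, Le, ← star_one]
  exact ⟨star_injective, fun h => by rw [h]⟩

/-- Cancellation of a sum without overflow. -/
theorem oplus_odot_star {x y : A} (h : Le x (∼y)) : odot (x ⊹ y) (∼y) = x := by
  have h' := h.star
  rw [star_star] at h'
  rw [odot, star_star, oplus_comm]
  apply star_injective
  rw [star_star, oplus_comm x]
  simpa only [star_star] using h'.eq_oplus

end MVAlgebra
end RieszMV

/-! ### Theories of Łukasiewicz logic, linear extensions and Lindenbaum chains -/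

namespace RieszMV
open MVAlgebra

/-- A set of formulas, in a language with a negation and an implication, that contains the
axioms of Łukasiewicz logic and is closed under modus ponens. -/
structure IsTheory {F : Type*} (neg : F → F) (imp : F → F → F) (T : Set F) : Prop where
  a1 : ∀ a b, imp a (imp b a) ∈ T
  a2 : ∀ a b c, imp (imp a b) (imp (imp b c) (imp a c)) ∈ T
  a3 : ∀ a b, imp (imp (imp a b) b) (imp (imp b a) a) ∈ T
  a4 : ∀ a b, imp (imp (neg a) (neg b)) (imp b a) ∈ T
  mp : ∀ {a b}, imp a b ∈ T → a ∈ T → b ∈ T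

namespace IsTheory

variable {F : Type*} {neg : F → F} {imp : F → F → F} {T : Set F}

local infixr:60 " ⇀ " => imp
local prefix:max "∼" => neg

theorem trans (hT : IsTheory neg imp T) {a b c : F} (h : a ⇀ b ∈ T) (h' : b ⇀ c ∈ T) :
    a ⇀ c ∈ T := hT.mp (hT.mp (hT.a2 a b c) h) h'

theorem imp_mono_left (hT : IsTheory neg imp T) {a b : F} (h : a ⇀ b ∈ T) (c : F) :
    (b ⇀ c) ⇀ (a ⇀ c) ∈ T := hT.mp (hT.a2 a b c) h

theorem weaken (hT : IsTheory neg imp T) {a : F} (h : a ∈ T) (b : F) : b ⇀ a ∈ T :=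
  hT.mp (hT.a1 a b) h

theorem assertion (hT : IsTheory neg imp T) (a b : F) : a ⇀ ((a ⇀ b) ⇀ b) ∈ T :=
  hT.trans (hT.a1 a (b ⇀ a)) (hT.a3 b a)

theorem exchange (hT : IsTheory neg imp T) (a b c : F) :
    (a ⇀ (b ⇀ c)) ⇀ (b ⇀ (a ⇀ c)) ∈ T :=
  hT.trans (hT.a2 a (b ⇀ c) c) (hT.imp_mono_left (hT.assertion b c) (a ⇀ c))

theorem refl (hT : IsTheory neg imp T) (a : F) : a ⇀ a ∈ T :=
  hT.mp (hT.mp (hT.exchange a (a ⇀ (a ⇀ a)) a) (hT.a1 a _)) (hT.a1 a a)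

theorem imp_mono_right (hT : IsTheory neg imp T) {b c : F} (h : b ⇀ c ∈ T) (a : F) :
    (a ⇀ b) ⇀ (a ⇀ c) ∈ T :=
  hT.mp (hT.mp (hT.exchange (a ⇀ b) (b ⇀ c) (a ⇀ c)) (hT.a2 a b c)) h

theorem detach (hT : IsTheory neg imp T) {a : F} (h : a ∈ T) (b : F) : (a ⇀ b) ⇀ b ∈ T :=
  hT.mp (hT.assertion a b) h

theorem neg_imp (hT : IsTheory neg imp T) (a b : F) : ∼a ⇀ (a ⇀ b) ∈ T :=
  hT.trans (hT.a1 (∼a) (∼b)) (hT.a4 b a)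

theorem neg_neg_imp (hT : IsTheory neg imp T) (a : F) : ∼(∼a) ⇀ a ∈ T :=
  hT.trans (hT.trans (hT.neg_imp (∼a) (∼(a ⇀ a))) (hT.a4 a (a ⇀ a))) (hT.detach (hT.refl a) a)

theorem imp_neg_neg (hT : IsTheory neg imp T) (a : F) : a ⇀ ∼(∼a) ∈ T :=
  hT.mp (hT.a4 (∼(∼a)) a) (hT.neg_neg_imp (∼a))

theorem contrapose (hT : IsTheory neg imp T) (a b : F) : (a ⇀ b) ⇀ (∼b ⇀ ∼a) ∈ T :=
  hT.trans (hT.trans (hT.imp_mono_left (hT.neg_neg_imp a) b)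
    (hT.imp_mono_right (hT.imp_neg_neg b) (∼(∼a)))) (hT.a4 (∼a) (∼b))

theorem imp_neg (hT : IsTheory neg imp T) {a b : F} (h : a ⇀ b ∈ T) : ∼b ⇀ ∼a ∈ T :=
  hT.mp (hT.contrapose a b) h

/-- Prelinearity. -/
theorem prelinear (hT : IsTheory neg imp T) (a b : F) :
    ((a ⇀ b) ⇀ (b ⇀ a)) ⇀ (b ⇀ a) ∈ T := by
  -- With `j` the disjunction of `a` and `b`, the hypothesis yields `(j ⇀ b) ⇀ (j ⇀ a)`.
  -- Contraposing and exchanging gives `∼a ⇀ ((∼b ⇀ ∼j) ⇀ ∼j)`. The conclusion of this is the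
  -- disjunction of `∼b` and `∼j`, which collapses to `∼b` because `∼j ⇀ ∼b`; a last contraposition
  -- gives `b ⇀ a`.
  have h1 := hT.imp_mono_left (hT.imp_mono_left (hT.assertion a b) b) (b ⇀ a)
  have h2 : (b ⇀ a) ⇀ (((a ⇀ b) ⇀ b) ⇀ a) ∈ T :=
    hT.trans (hT.assertion (b ⇀ a) a) (hT.imp_mono_left (hT.a3 a b) a)
  generalize hj : (a ⇀ b) ⇀ b = j at h1 h2
  have hbj : b ⇀ j ∈ T := hj ▸ hT.a1 b (a ⇀ b)
  have h3 := hT.trans h1 (hT.imp_mono_right h2 (j ⇀ b))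
  have h4 := hT.trans h3 (hT.imp_mono_right (hT.contrapose j a) (j ⇀ b))
  have h5 := hT.trans h4 (hT.imp_mono_left (hT.a4 b j) (∼a ⇀ ∼j))
  have h6 := hT.trans h5 (hT.exchange (∼b ⇀ ∼j) (∼a) (∼j))
  have h7 := hT.trans (hT.a3 (∼b) (∼j)) (hT.detach (hT.imp_neg hbj) (∼b))
  exact hT.trans (hT.trans h6 (hT.imp_mono_right h7 (∼a))) (hT.a4 a b)

/-- Modus ponens under a disjunction. -/
theorem or_mp (hT : IsTheory neg imp T) {x y b : F} (h : ((x ⇀ y) ⇀ b) ⇀ b ∈ T)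
    (h' : (x ⇀ b) ⇀ b ∈ T) : (y ⇀ b) ⇀ b ∈ T := by
  have h1 := hT.trans (hT.a2 x y b) (hT.imp_mono_right h' (y ⇀ b))
  exact hT.trans (hT.assertion (y ⇀ b) b) (hT.trans (hT.imp_mono_left h1 b) h)

/-- The theory generated by `T` and one further formula. -/
inductive Adjoin (imp : F → F → F) (T : Set F) (a : F) : F → Prop
  | self : Adjoin imp T a a
  | base {b : F} : b ∈ T → Adjoin imp T a b
  | mp {b c : F} : Adjoin imp T a (imp b c) → Adjoin imp T a b → Adjoin imp T a c

theorem adjoin (hT : IsTheory neg imp T) (a : F) : IsTheory neg imp {b | Adjoin imp T a b} where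
  a1 _ _ := .base (hT.a1 _ _)
  a2 _ _ _ := .base (hT.a2 _ _ _)
  a3 _ _ := .base (hT.a3 _ _)
  a4 _ _ := .base (hT.a4 _ _)
  mp := .mp

/-- Łukasiewicz logic lacks contraction, hence also the classical deduction theorem. Disjunction
with a fixed `b` serves instead, since by `or_mp` it survives each modus ponens of the derivation.
-/
theorem or_mem_of_adjoin (hT : IsTheory neg imp T) {a b c : F} (h : (a ⇀ b) ⇀ b ∈ T)
    (hc : Adjoin imp T a c) : (c ⇀ b) ⇀ b ∈ T := by
  induction hc with
  | self => exact h
  | base hd => exact hT.mp (hT.assertion _ b) hd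
  | mp _ _ ih ih' => exact hT.or_mp ih ih'

/-- If `a ∨ b` belongs to a theory and `c` follows both from `a` and from `b`, then `c` belongs
to the theory. -/
theorem mem_of_adjoin (hT : IsTheory neg imp T) {a b c : F} (h : (a ⇀ b) ⇀ b ∈ T)
    (ha : Adjoin imp T a c) (hb : Adjoin imp T b c) : c ∈ T := by
  -- The first disjunct is replaced by `c`, the two sides are swapped by `a3`, and the other
  -- disjunct is replaced by `c` too; "`c` or `c`" then gives `c`.
  have h1 := hT.mp (hT.a3 c b) (hT.or_mem_of_adjoin h ha)
  exact hT.mp (hT.or_mem_of_adjoin h1 hb) (hT.refl c)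

/-- Every formula outside a theory is omitted by a linear extension of the theory. -/
theorem exists_linear (hT : IsTheory neg imp T) {p : F} (hp : p ∉ T) :
    ∃ M, T ⊆ M ∧ IsTheory neg imp M ∧ p ∉ M ∧ ∀ a b, a ⇀ b ∈ M ∨ b ⇀ a ∈ M := by
  obtain ⟨M, hTM, hM⟩ := zorn_subset_nonempty {S : Set F | IsTheory neg imp S ∧ p ∉ S}
    (fun C hC hch hne => by
      obtain ⟨S, hS⟩ := hne
      refine ⟨⋃₀ C, ⟨?_, ?_⟩, fun s hs => Set.subset_sUnion_of_mem hs⟩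
      · refine ⟨fun a b => ⟨S, hS, (hC hS).1.a1 a b⟩, fun a b c => ⟨S, hS, (hC hS).1.a2 a b c⟩,
          fun a b => ⟨S, hS, (hC hS).1.a3 a b⟩, fun a b => ⟨S, hS, (hC hS).1.a4 a b⟩, ?_⟩
        rintro a b ⟨S₁, h₁, hab⟩ ⟨S₂, h₂, ha⟩
        rcases hch.total h₁ h₂ with h | h
        · exact ⟨S₂, h₂, (hC h₂).1.mp (h hab) ha⟩
        · exact ⟨S₁, h₁, (hC h₁).1.mp hab (h ha)⟩
      · rintro ⟨S₁, h₁, h⟩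
        exact (hC h₁).2 h) T ⟨hT, hp⟩
  have hM1 := hM.prop.1
  -- By maximality any formula outside `M` derives `p` over `M`. If both implications were outside,
  -- prelinearity would put `p` in `M`.
  have key : ∀ a, a ∉ M → Adjoin imp M a p := fun a ha => by
    by_contra h
    exact ha (hM.le_of_ge (y := {b | Adjoin imp M a b}) ⟨hM1.adjoin a, h⟩
      (fun b hb => .base hb) .self)
  refine ⟨M, hTM, hM1, hM.prop.2, fun a b => ?_⟩
  by_contra! h
  exact hM.prop.2 (hM1.mem_of_adjoin (hM1.prelinear a b) (key _ h.1) (key _ h.2))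

/-- Provable equivalence with respect to a theory. -/
def setoid (hT : IsTheory neg imp T) : Setoid F where
  r a b := a ⇀ b ∈ T ∧ b ⇀ a ∈ T
  iseqv := ⟨fun a => ⟨hT.refl a, hT.refl a⟩, fun h => ⟨h.2, h.1⟩,
    fun h h' => ⟨hT.trans h.1 h'.1, hT.trans h'.2 h.2⟩⟩

/-- The Lindenbaum algebra of a theory. -/
def Lindenbaum (hT : IsTheory neg imp T) : Type _ := Quotient hT.setoid

/-- The class of a formula in the Lindenbaum algebra. -/
def cls (hT : IsTheory neg imp T) (a : F) : hT.Lindenbaum := Quotient.mk hT.setoid a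

theorem cls_eq_iff (hT : IsTheory neg imp T) {a b : F} :
    hT.cls a = hT.cls b ↔ a ⇀ b ∈ T ∧ b ⇀ a ∈ T := Quotient.eq (r := hT.setoid)

theorem cls_eq (hT : IsTheory neg imp T) {a b : F} (h : a ⇀ b ∈ T) (h' : b ⇀ a ∈ T) :
    hT.cls a = hT.cls b := hT.cls_eq_iff.2 ⟨h, h'⟩

theorem cls_surjective (hT : IsTheory neg imp T) : Function.Surjective hT.cls :=
  Quotient.mk_surjective

/-- The MV-operations on the Lindenbaum algebra. -/
abbrev mvAlgebra [Inhabited F] (hT : IsTheory neg imp T) : MVAlgebra hT.Lindenbaum where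
  oplus := Quotient.map₂ (fun a b => ∼a ⇀ b) fun a a' h b b' h' =>
    ⟨hT.trans (hT.imp_mono_left (hT.imp_neg h.1) b) (hT.imp_mono_right h'.1 (∼a')),
      hT.trans (hT.imp_mono_left (hT.imp_neg h.2) b') (hT.imp_mono_right h'.2 (∼a))⟩
  star := Quotient.map neg fun a a' h => ⟨hT.imp_neg h.2, hT.imp_neg h.1⟩
  zero := hT.cls (∼(default ⇀ default))
  oplus_assoc := by
    rintro ⟨a⟩ ⟨b⟩ ⟨c⟩
    have hc : ∀ a b : F, (∼a ⇀ b) ⇀ (∼b ⇀ a) ∈ T := fun a b =>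
      hT.trans (hT.contrapose (∼a) b) (hT.imp_mono_right (hT.neg_neg_imp a) (∼b))
    exact hT.cls_eq
      (hT.trans (hT.trans (hc _ _) (hT.exchange _ _ _)) (hT.imp_mono_right (hc _ _) _))
      (hT.trans (hT.trans (hT.imp_mono_right (hc _ _) _) (hT.exchange _ _ _)) (hc _ _))
  oplus_comm := by
    rintro ⟨a⟩ ⟨b⟩
    have hc : ∀ a b : F, (∼a ⇀ b) ⇀ (∼b ⇀ a) ∈ T := fun a b =>
      hT.trans (hT.contrapose (∼a) b) (hT.imp_mono_right (hT.neg_neg_imp a) (∼b))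
    exact hT.cls_eq (hc _ _) (hc _ _)
  zero_oplus := by
    rintro ⟨a⟩
    exact hT.cls_eq (hT.detach (hT.mp (hT.imp_neg_neg _) (hT.refl _)) a) (hT.a1 _ _)
  star_star := by
    rintro ⟨a⟩
    exact hT.cls_eq (hT.neg_neg_imp a) (hT.imp_neg_neg a)
  star_zero_oplus := by
    rintro ⟨a⟩
    have h := hT.mp (hT.imp_neg_neg _) (hT.refl default)
    exact hT.cls_eq (hT.weaken h _)
      (hT.weaken (hT.mp (hT.neg_imp _ _) (hT.mp (hT.imp_neg_neg _) h)) _)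
  luk := by
    rintro ⟨a⟩ ⟨b⟩
    have h : ∀ a b : F, (∼(∼(∼(∼a) ⇀ b)) ⇀ b) ⇀ (∼(∼(∼(∼b) ⇀ a)) ⇀ a) ∈ T := fun a b =>
      hT.trans (hT.trans (hT.trans (hT.imp_mono_left (hT.imp_neg_neg _) b)
        (hT.imp_mono_left (hT.imp_mono_left (hT.neg_neg_imp a) b) b)) (hT.a3 a b))
        (hT.imp_mono_left (hT.trans (hT.neg_neg_imp _)
          (hT.imp_mono_left (hT.imp_neg_neg b) a)) a)
    exact hT.cls_eq (h a b) (h b a)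

end IsTheory

/-- Nontrivial totally ordered MV-algebras. -/
class IsMVChain (C : Type*) [MVAlgebra C] : Prop where
  total : ∀ x y : C, Le x y ∨ Le y x
  zero_ne_one : (zero : C) ≠ one

/-- A formula outside a theory is refuted by a homomorphism onto an MV-chain under which the
theory holds. -/
theorem IsTheory.exists_chain {F : Type u} [Inhabited F] {neg : F → F} {imp : F → F → F}
    {T : Set F} (hT : IsTheory neg imp T) {p : F} (hp : p ∉ T) :
    ∃ (C : Type u) (_ : MVAlgebra C) (_ : IsMVChain C) (e : F → C),
      Function.Surjective e ∧ (∀ a b, e (imp a b) = oplus (star (e a)) (e b)) ∧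
      (∀ a, e (neg a) = star (e a)) ∧ (∀ a ∈ T, e a = one) ∧ e p ≠ one := by
  obtain ⟨M, hTM, hM, hpM, hlin⟩ := hT.exists_linear hp
  let _ := hM.mvAlgebra
  have hneg : ∀ a, hM.cls (neg a) = star (hM.cls a) := fun a => rfl
  have himp : ∀ a b, hM.cls (imp a b) = oplus (star (hM.cls a)) (hM.cls b) := fun a b =>
    hM.cls_eq (hM.imp_mono_left (hM.neg_neg_imp a) b) (hM.imp_mono_left (hM.imp_neg_neg a) b)
  have hone : ∀ a, hM.cls a = one ↔ a ∈ M := fun a => by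
    have h1 : hM.cls (imp default default) = one := by
      rw [himp, star_oplus_self]
    rw [← h1, hM.cls_eq_iff]
    exact ⟨fun h => hM.mp h.2 (hM.refl _), fun h => ⟨hM.weaken (hM.refl _) _, hM.weaken h _⟩⟩
  refine ⟨hM.Lindenbaum, hM.mvAlgebra, ⟨?_, ?_⟩, hM.cls, hM.cls_surjective, himp, hneg,
    fun a ha => (hone a).2 (hTM ha), fun h => hpM ((hone p).1 h)⟩
  · intro x y
    obtain ⟨a, rfl⟩ := hM.cls_surjective x
    obtain ⟨b, rfl⟩ := hM.cls_surjective y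
    rw [Le, Le, ← himp, ← himp, hone, hone]
    exact hlin a b
  · intro h
    refine hpM ((hone p).1 ?_)
    rw [← zero_oplus (hM.cls p), h, one_oplus]

end RieszMV

/-! ### Chang's ordered group of an MV-chain -/

namespace RieszMV
open MVAlgebra

local infixl:65 " ⊹ " => oplus
local prefix:max "∼" => star

namespace MVAlgebra

variable {A : Type*} [MVAlgebra A] {a b c : A}

/-- This lemma and the next two are the cases of associativity for addition with carry, according to
whether `a + b` and `b + c` overflow. Here neither does: `c` is written as `(c ⊹ b) ⊙ ∼b`, and the
`∼b` cancels against `a ⊹ b`. -/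
theorem oplus_odot_of_le_star (ha : Le a (∼b)) (hc : Le c (∼b)) :
    odot (a ⊹ b) c = odot a (b ⊹ c) := by
  conv_lhs => rw [← oplus_odot_star hc, odot_comm (c ⊹ b), ← odot_assoc, oplus_odot_star ha,
    oplus_comm c b]

theorem odot_oplus_of_star_le (ha : Le (∼b) a) (hc : Le (∼b) c) :
    odot a b ⊹ c = a ⊹ odot b c := by
  have ha' : Le (∼a) (∼(∼b)) := ha.star
  have hc' : Le (∼c) (∼(∼b)) := hc.star
  apply star_injective
  have h := oplus_odot_of_le_star ha' hc'
  simpa only [odot, star_star] using h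

/-- One inequality is residuation. For the other, the left side lies above `a`, so it can be
recovered by subtracting `a`, which leaves `b ⊙ c`, and adding `a` back. -/
theorem oplus_odot_of_le_star_le (ha : Le a (∼b)) (hc : Le (∼b) c) :
    odot (a ⊹ b) c = a ⊹ odot b c := by
  have hb : Le b (∼a) := by
    have h := ha.star
    rwa [star_star] at h
  have hcb : ∼c ⊹ odot b c = b := by
    have h := (le_star_comm.1 hc).eq_oplus
    rwa [oplus_comm (∼c) (∼b)] at h
  apply Le.antisymm
  · rw [odot_le_iff, oplus_left_comm, hcb]
    exact Le.refl _
  · have h1 : Le a (odot (a ⊹ b) c) := by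
      have h := hc.odot_left (a ⊹ b)
      rwa [oplus_odot_star ha] at h
    have h2 : odot (∼a) (odot (a ⊹ b) c) = odot b c := by
      rw [← odot_assoc, odot_comm (∼a), oplus_comm a b, oplus_odot_star hb]
    have h3 : a ⊹ odot (∼a) (odot (a ⊹ b) c) = odot (a ⊹ b) c := by
      have h := h1.eq_oplus
      rwa [odot, star_star]
    rw [← h2, h3]
    exact Le.refl _

theorem star_le_iff : Le (∼a) b ↔ a ⊹ b = one := by rw [Le, star_star]

theorem odot_ne_one (h : a ≠ one) (b : A) : odot a b ≠ one := fun h' =>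
  h (eq_one_of_one_le (h' ▸ odot_le_left a b))

theorem star_ne_one (h : a ≠ zero) : ∼a ≠ one := fun h' =>
  h (star_injective h')

end MVAlgebra

namespace IsMVChain

variable {C : Type*} [MVAlgebra C] [IsMVChain C] {a b : C}

/-- Totality enters here: a sum different from 1 was not truncated, so the cancellation laws apply
to it. -/
theorem le_star (h : a ⊹ b ≠ one) : Le a (∼b) := by
  rcases total a (∼b) with h' | h'
  · exact h'
  · exact absurd (oplus_comm b a ▸ star_le_iff.1 h') h

end IsMVChain

open IsMVChain

/-- Chang's group of an MV-chain: pairs of an integer part and a fractional part. -/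
@[ext]
structure ChangGroup (C : Type u) [MVAlgebra C] : Type u where
  int : ℤ
  frac : C
  frac_ne_one : frac ≠ one

namespace ChangGroup

variable {C : Type u} [MVAlgebra C]

open Classical in
/-- Addition with carry. -/
noncomputable instance : Add (ChangGroup C) where
  add g h := if hh : g.frac ⊹ h.frac = one
    then ⟨g.int + h.int + 1, odot g.frac h.frac, odot_ne_one g.frac_ne_one _⟩
    else ⟨g.int + h.int, g.frac ⊹ h.frac, hh⟩

theorem add_of_eq {g h : ChangGroup C} (hh : g.frac ⊹ h.frac = one) :
    g + h = ⟨g.int + h.int + 1, odot g.frac h.frac, odot_ne_one g.frac_ne_one _⟩ := dif_pos hh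

theorem add_of_ne {g h : ChangGroup C} (hh : g.frac ⊹ h.frac ≠ one) :
    g + h = ⟨g.int + h.int, g.frac ⊹ h.frac, hh⟩ := dif_neg hh

protected theorem add_comm (g h : ChangGroup C) : g + h = h + g := by
  by_cases hh : g.frac ⊹ h.frac = one
  · rw [add_of_eq hh, add_of_eq (by rwa [oplus_comm])]
    ext1
    · simp only [add_comm]
    · exact odot_comm _ _
  · rw [add_of_ne hh, add_of_ne (by rwa [oplus_comm])]
    ext1
    · simp only [add_comm]
    · exact oplus_comm _ _

theorem int_add_le (g h : ChangGroup C) : g.int + h.int ≤ (g + h).int := by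
  by_cases hh : g.frac ⊹ h.frac = one
  · rw [add_of_eq hh]
    exact (lt_add_one _).le
  · rw [add_of_ne hh]

variable [hC : IsMVChain C]

instance : Zero (ChangGroup C) := ⟨⟨0, zero, hC.zero_ne_one⟩⟩

open Classical in
noncomputable instance : Neg (ChangGroup C) where
  neg g := if h : g.frac = zero then ⟨-g.int, zero, hC.zero_ne_one⟩
    else ⟨-g.int - 1, ∼g.frac, star_ne_one h⟩

theorem neg_of_eq {g : ChangGroup C} (h : g.frac = zero) :
    -g = ⟨-g.int, zero, hC.zero_ne_one⟩ := dif_pos h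

theorem neg_of_ne {g : ChangGroup C} (h : g.frac ≠ zero) :
    -g = ⟨-g.int - 1, ∼g.frac, star_ne_one h⟩ := dif_neg h

protected theorem add_assoc (g h k : ChangGroup C) : g + h + k = g + (h + k) := by
  obtain ⟨l, a, ha⟩ := g
  obtain ⟨m, b, hb⟩ := h
  obtain ⟨n, c, hc⟩ := k
  by_cases hab : a ⊹ b = one
  · have hab' : Le (∼b) a := star_le_iff.2 (oplus_comm a b ▸ hab)
    rw [add_of_eq (g := ⟨l, a, ha⟩) (h := ⟨m, b, hb⟩) hab]
    by_cases hbc : b ⊹ c = one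
    · have e := odot_oplus_of_star_le hab' (star_le_iff.2 hbc)
      rw [add_of_eq (g := ⟨m, b, hb⟩) (h := ⟨n, c, hc⟩) hbc]
      by_cases h : odot a b ⊹ c = one
      · rw [add_of_eq h, add_of_eq (e ▸ h)]
        ext1
        · simp only; ring
        · exact odot_assoc _ _ _
      · rw [add_of_ne h, add_of_ne (e ▸ h)]
        ext1
        · simp only; ring
        · exact e
    · have hcb : Le c (∼b) := le_star (oplus_comm b c ▸ hbc)
      have e : odot a (b ⊹ c) = odot a b ⊹ c := by
        rw [odot_comm, oplus_comm b, oplus_odot_of_le_star_le hcb hab', oplus_comm,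
          odot_comm]
      have h1 : a ⊹ (b ⊹ c) = one := by rw [← oplus_assoc, hab, one_oplus]
      have h2 : odot a b ⊹ c ≠ one := e ▸ odot_ne_one ha _
      rw [add_of_ne (g := ⟨m, b, hb⟩) (h := ⟨n, c, hc⟩) hbc, add_of_ne h2, add_of_eq h1]
      ext1
      · simp only; ring
      · exact e.symm
  · have hab' : Le a (∼b) := le_star hab
    rw [add_of_ne (g := ⟨l, a, ha⟩) (h := ⟨m, b, hb⟩) hab]
    by_cases hbc : b ⊹ c = one
    · have e := oplus_odot_of_le_star_le hab' (star_le_iff.2 hbc)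
      have h1 : a ⊹ b ⊹ c = one := by rw [oplus_assoc, hbc, oplus_one]
      have h2 : a ⊹ odot b c ≠ one := e ▸ odot_ne_one hab _
      rw [add_of_eq (g := ⟨m, b, hb⟩) (h := ⟨n, c, hc⟩) hbc, add_of_eq h1, add_of_ne h2]
      ext1
      · simp only; ring
      · exact e
    · have e := oplus_odot_of_le_star hab' (le_star (oplus_comm b c ▸ hbc))
      rw [add_of_ne (g := ⟨m, b, hb⟩) (h := ⟨n, c, hc⟩) hbc]
      by_cases h : a ⊹ b ⊹ c = one
      · rw [add_of_eq h, add_of_eq (oplus_assoc a b c ▸ h)]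
        ext1
        · simp only; ring
        · exact e
      · rw [add_of_ne h, add_of_ne (oplus_assoc a b c ▸ h)]
        ext1
        · simp only; ring
        · exact oplus_assoc _ _ _

protected theorem zero_add (g : ChangGroup C) : 0 + g = g := by
  have h : (0 : ChangGroup C).frac ⊹ g.frac ≠ one := by
    change zero ⊹ _ ≠ _
    rw [zero_oplus]
    exact g.frac_ne_one
  rw [add_of_ne h]
  ext1
  · exact zero_add _
  · exact zero_oplus _

protected theorem neg_add_cancel (g : ChangGroup C) : -g + g = 0 := by
  by_cases h : g.frac = zero
  · have h1 : zero ⊹ g.frac ≠ one := by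
      rw [zero_oplus]
      exact g.frac_ne_one
    rw [neg_of_eq h, add_of_ne h1]
    ext1
    · exact neg_add_cancel _
    · change zero ⊹ _ = zero
      rw [h, zero_oplus]
  · rw [neg_of_ne h, add_of_eq (star_oplus_self _)]
    ext1
    · change -g.int - 1 + g.int + 1 = 0
      ring
    · change odot (∼g.frac) g.frac = zero
      rw [odot, MVAlgebra.star_star, oplus_star_self, MVAlgebra.star_one]

noncomputable instance : AddCommGroup (ChangGroup C) where
  add_assoc := ChangGroup.add_assoc
  zero_add := ChangGroup.zero_add
  add_zero g := by rw [ChangGroup.add_comm, ChangGroup.zero_add]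
  neg_add_cancel := ChangGroup.neg_add_cancel
  add_comm := ChangGroup.add_comm
  nsmul := nsmulRec
  zsmul := zsmulRec

/-- The elements with nonnegative integer part. -/
def cone (C : Type u) [MVAlgebra C] [hC : IsMVChain C] : AddGroupCone (ChangGroup C) where
  carrier := {g | 0 ≤ g.int}
  add_mem' {g h} hg hh := (add_nonneg hg hh).trans (int_add_le g h)
  zero_mem' := le_refl (0 : ℤ)
  eq_zero_of_mem_of_neg_mem' {g} hg hg' := by
    simp only [Set.mem_ofPred_eq] at hg hg'
    by_cases h : g.frac = zero
    · rw [neg_of_eq h] at hg'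
      simp only at hg'
      ext1
      · change g.int = 0
        omega
      · exact h
    · rw [neg_of_ne h] at hg'
      simp only at hg'
      omega

instance : HasMemOrNegMem (cone C) where
  mem_or_neg_mem g := by
    change 0 ≤ g.int ∨ 0 ≤ (-g).int
    by_cases h : g.frac = zero
    · rw [neg_of_eq h]
      simp only
      omega
    · rw [neg_of_ne h]
      simp only
      omega

open Classical in
noncomputable instance : LinearOrder (ChangGroup C) := LinearOrder.mkOfAddGroupCone (cone C)

instance : IsOrderedAddMonoid (ChangGroup C) := IsOrderedAddMonoid.mkOfCone (cone C)

theorem nonneg_iff {g : ChangGroup C} : 0 ≤ g ↔ 0 ≤ g.int := by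
  change 0 ≤ (g - 0).int ↔ _
  rw [sub_zero]

/-- The strong unit of Chang's group. -/
def unit (C : Type u) [MVAlgebra C] [hC : IsMVChain C] : ChangGroup C :=
  ⟨1, zero, hC.zero_ne_one⟩

open Classical in
/-- The embedding of an MV-chain in the unit interval of its group. -/
noncomputable def of (a : C) : ChangGroup C :=
  if h : a = one then unit C else ⟨0, a, h⟩

theorem of_one : of (one : C) = unit C := dif_pos rfl

theorem of_of_ne {a : C} (h : a ≠ one) : of a = ⟨0, a, h⟩ := dif_neg h

theorem of_zero : of (zero : C) = 0 := of_of_ne hC.zero_ne_one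

theorem of_nonneg (a : C) : 0 ≤ of a := by
  rw [nonneg_iff]
  by_cases h : a = one
  · rw [h, of_one]
    exact zero_le_one
  · rw [of_of_ne h]

theorem of_add_of_ne {a b : C} (h : a ⊹ b ≠ one) : of a + of b = of (a ⊹ b) := by
  have ha : a ≠ one := by
    rintro rfl
    exact h (one_oplus b)
  have hb : b ≠ one := by
    rintro rfl
    exact h (oplus_one a)
  rw [of_of_ne ha, of_of_ne hb, of_of_ne h]
  exact add_of_ne h

/-- The carry rule of the group, valid also when a summand is 1 and so has integer part 1. With `b =
∼a` it computes the complement. -/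
theorem of_add_of_eq {a b : C} (h : a ⊹ b = one) : of a + of b = unit C + of (odot a b) := by
  by_cases ha : a = one
  · rw [ha, of_one, odot, MVAlgebra.star_one, zero_oplus, MVAlgebra.star_star]
  by_cases hb : b = one
  · rw [hb, of_one, odot, MVAlgebra.star_one, oplus_zero, MVAlgebra.star_star, add_comm]
  rw [of_of_ne ha, of_of_ne hb, of_of_ne (odot_ne_one ha _), add_of_eq h, add_of_ne]
  · ext1
    · change (0 : ℤ) + 0 + 1 = 1 + 0
      rfl
    · exact (zero_oplus _).symm
  · change zero ⊹ _ ≠ _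
    rw [zero_oplus]
    exact odot_ne_one ha _

theorem of_star (a : C) : of (∼a) = unit C - of a := by
  rw [eq_sub_iff_add_eq, of_add_of_eq (star_oplus_self a), odot, MVAlgebra.star_star,
    oplus_star_self, MVAlgebra.star_one, of_zero, add_zero]

theorem of_le_unit (a : C) : of a ≤ unit C := by
  rw [← sub_nonneg, ← of_star]
  exact of_nonneg _

theorem of_oplus (a b : C) : of (a ⊹ b) = min (unit C) (of a + of b) := by
  by_cases h : a ⊹ b = one
  · rw [h, of_one, of_add_of_eq h, min_eq_left]
    exact le_add_of_nonneg_right (of_nonneg _)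
  · rw [of_add_of_ne h, min_eq_right (of_le_unit _)]

theorem of_injective : Function.Injective (of : C → ChangGroup C) := by
  intro a b h
  by_cases ha : a = one <;> by_cases hb : b = one
  · rw [ha, hb]
  · rw [ha, of_one, of_of_ne hb] at h
    exact absurd (congrArg int h) one_ne_zero
  · rw [hb, of_one, of_of_ne ha] at h
    exact absurd (congrArg int h) zero_ne_one
  · rw [of_of_ne ha, of_of_ne hb] at h
    exact congrArg frac h

/-- Truncated subtraction becomes the positive part of a difference; this is how the Riesz axioms
turn into additivity statements. -/
theorem of_odot_star (a b : C) : of (odot a (∼b)) = max 0 (of a - of b) := by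
  rw [odot, MVAlgebra.star_star, of_star, of_oplus, of_star]
  rcases le_total (of a) (of b) with h | h
  · rw [max_eq_left (sub_nonpos.2 h), min_eq_left, sub_self]
    rw [sub_add, le_sub_self_iff]
    exact sub_nonpos.2 h
  · rw [max_eq_right (sub_nonneg.2 h), min_eq_right]
    · abel
    · rw [sub_add, sub_le_self_iff]
      exact sub_nonneg.2 h

theorem zsmul_unit (n : ℤ) : n • unit C = ⟨n, zero, hC.zero_ne_one⟩ := by
  let f : ℤ →+ ChangGroup C := AddMonoidHom.mk' (fun k => ⟨k, zero, hC.zero_ne_one⟩)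
    fun k l => by
      have h : (zero : C) ⊹ zero ≠ one := by
        rw [zero_oplus]
        exact hC.zero_ne_one
      rw [add_of_ne h]
      ext1
      · rfl
      · exact (zero_oplus _).symm
  have h := map_zsmul f n 1
  rw [zsmul_one, Int.cast_id] at h
  exact h.symm

/-- The chain generates the group, so additive maps are determined on it and the formula used in
`lift` is forced. -/
theorem eq_zsmul_add (g : ChangGroup C) : g.int • unit C + of g.frac = g := by
  have h : zero ⊹ g.frac ≠ one := by
    rw [zero_oplus]
    exact g.frac_ne_one
  rw [zsmul_unit, of_of_ne g.frac_ne_one, add_of_ne h]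
  ext1
  · exact add_zero _
  · exact zero_oplus _

variable {H : Type*} [AddCommGroup H]

theorem hom_ext {f f' : ChangGroup C →+ H} (h : ∀ a, f (of a) = f' (of a)) : f = f' := by
  ext g
  rw [← eq_zsmul_add g, map_add, map_add, map_zsmul, map_zsmul, ← of_one, h, h]

/-- The extension to Chang's group of a map on an MV-chain that preserves the sums without
overflow. -/
noncomputable def lift (f : C → H) (hf : ∀ a b c, of c = of a + of b → f c = f a + f b) :
    ChangGroup C →+ H := AddMonoidHom.mk' (fun g => g.int • f one + f g.frac) fun g h => by
  by_cases hh : g.frac ⊹ h.frac = one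
  · have h1 := of_add_of_eq hh
    -- In the carry case `h.frac` is the overflow-free sum of `∼g.frac` and the new fractional part.
    -- The complement then combines with `g.frac` to give the carried unit.
    have h2 : f one = f g.frac + f (∼g.frac) := hf _ _ _ (by rw [of_star, of_one]; abel)
    have h3 : f h.frac = f (∼g.frac) + f (odot g.frac h.frac) := hf _ _ _ (by
      rw [of_star, ← sub_eq_zero]
      rw [← sub_eq_zero] at h1
      rw [← h1]
      abel)
    rw [add_of_eq hh]
    simp only [add_smul, one_smul]
    rw [h3]
    nth_rewrite 3 [h2]
    abel
  · rw [add_of_ne hh]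
    simp only [add_smul]
    rw [hf _ _ _ (of_add_of_ne hh).symm]
    abel

theorem lift_of (f : C → H) (hf : ∀ a b c, of c = of a + of b → f c = f a + f b) (a : C) :
    lift f hf (of a) = f a := by
  have h0 : f zero = 0 := by
    have h := hf zero zero zero (by rw [of_zero, add_zero])
    exact left_eq_add.1 h
  by_cases h : a = one
  · rw [h, of_one]
    change (1 : ℤ) • f one + f zero = _
    rw [h0, one_smul, add_zero]
  · rw [of_of_ne h]
    change (0 : ℤ) • f one + f a = _
    rw [zero_smul, zero_add]

end ChangGroup
end RieszMV

/-! ### Transfer of linear inequalities to the reals -/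

namespace RieszMV
open MVAlgebra

/-- Between finitely many lower and finitely many upper bounds there is a real number, which can
be chosen to attain a bound only when some bound on the opposite side forces it. -/
theorem exists_real_between {α : Type*} (P N : Finset α) (l : α → ℝ)
    (h : ∀ p ∈ P, ∀ n ∈ N, l p ≤ l n) :
    ∃ t : ℝ, (∀ p ∈ P, l p ≤ t ∧ ((∀ n ∈ N, l p < l n) → l p < t)) ∧
      ∀ n ∈ N, t ≤ l n ∧ ((∀ p ∈ P, l p < l n) → t < l n) := by
  rcases P.eq_empty_or_nonempty with rfl | hP
  · rcases N.eq_empty_or_nonempty with rfl | hN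
    · simp
    · obtain ⟨n₀, hn₀, hmin⟩ := N.exists_min_image l hN
      refine ⟨l n₀ - 1, by simp, fun n hn => ?_⟩
      have := hmin n hn
      exact ⟨by linarith, fun _ => by linarith⟩
  · obtain ⟨p₀, hp₀, hmax⟩ := P.exists_max_image l hP
    rcases N.eq_empty_or_nonempty with rfl | hN
    · refine ⟨l p₀ + 1, fun p hp => ?_, by simp⟩
      have := hmax p hp
      exact ⟨by linarith, fun _ => by linarith⟩
    · obtain ⟨n₀, hn₀, hmin⟩ := N.exists_min_image l hN
      have h₀ := h p₀ hp₀ n₀ hn₀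
      -- The midpoint of the tightest bounds meets one of them only if they coincide.
      refine ⟨(l p₀ + l n₀) / 2, fun p hp => ?_, fun n hn => ?_⟩
      · have := hmax p hp
        refine ⟨by linarith, fun hs => ?_⟩
        have := hs n₀ hn₀
        linarith
      · have := hmin n hn
        refine ⟨by linarith, fun hs => ?_⟩
        have := hs p₀ hp₀
        linarith

open Finsupp in
theorem linearCombination_add_single {R ι : Type*} [CommRing R] [Algebra R ℝ] [DecidableEq ι]
    (y : ι → ℝ) (i : ι) (δ : ℝ)
    (c : ι →₀ R) :
    linearCombination R (fun j => y j + if j = i then δ else 0) c =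
      linearCombination R y c + c i • δ := by
  simp only [linearCombination_apply, smul_add, Finsupp.sum_add, smul_ite, smul_zero]
  congr 1
  rw [Finsupp.sum, Finset.sum_ite_eq']
  split_ifs with h
  · rfl
  · rw [Finsupp.notMem_support_iff.1 h, zero_smul]

section FourierMotzkin

variable {R : Type*} [CommRing R] [LinearOrder R] [IsStrictOrderedRing R] [Algebra R ℝ]
  {G : Type*} [AddCommGroup G] [LinearOrder G] [IsOrderedAddMonoid G] [Module R G]
  [PosSMulStrictMono R G]

open Finsupp Classical in
/-- Fourier–Motzkin elimination: a finite system of homogeneous linear inequalities that is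
solvable in a totally ordered module is solvable in the real numbers. -/
theorem exists_real_solution {ι : Type*} (hR : ∀ c : R, 0 < c → 0 < algebraMap R ℝ c)
    (x : ι → G) (s : Finset ι) : ∀ F : Finset (ι →₀ R), (∀ c ∈ F, c.support ⊆ s) →
    (∀ c ∈ F, 0 ≤ linearCombination R x c) →
    ∃ y : ι → ℝ, ∀ c ∈ F, 0 ≤ linearCombination R y c ∧
      (0 < linearCombination R x c → 0 < linearCombination R y c) := by
  induction s using Finset.induction_on with
  | empty =>
    intro F hF _
    refine ⟨0, fun c hc => ?_⟩
    have h0 : c = 0 := Finsupp.support_eq_empty.1 (Finset.subset_empty.1 (hF c hc))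
    simp [h0]
  | insert i s his ih =>
    intro F hF hx
    let P := F.filter fun c => 0 < c i
    let N := F.filter fun c => c i < 0
    -- The combination of an inequality with positive and one with negative `i`-th coefficient that
    -- cancels coordinate `i`. Both multipliers `-d i` and `c i` are positive, so validity and
    -- strictness at `x` are inherited.
    let comb : (ι →₀ R) → (ι →₀ R) → ι →₀ R := fun c d => (-d i) • c + c i • d
    have hcomb : ∀ {M : Type _} [AddCommGroup M] [Module R M] (z : ι → M) (c d : ι →₀ R),
        linearCombination R z (comb c d) =
          (-d i) • linearCombination R z c + c i • linearCombination R z d := by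
      intro M _ _ z c d
      simp only [comb, map_add, map_smul]
    have hcombR : ∀ (z : ι → ℝ) (c d : ι →₀ R),
        linearCombination R z (comb c d) =
          (-d i) • linearCombination R z c + c i • linearCombination R z d := by
      intro z c d
      simp only [comb, map_add, map_smul]
    have hP : ∀ c ∈ P, c ∈ F ∧ 0 < c i := fun c hc => Finset.mem_filter.1 hc
    have hN : ∀ c ∈ N, c ∈ F ∧ c i < 0 := fun c hc => Finset.mem_filter.1 hc
    have hsupp : ∀ c : ι →₀ R, c.support ⊆ insert i s → c i = 0 → c.support ⊆ s := by
      intro c hc h0 j hj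
      rcases Finset.mem_insert.1 (hc hj) with rfl | h
      · exact absurd h0 (Finsupp.mem_support_iff.1 hj)
      · exact h
    obtain ⟨y, hy⟩ := ih (F.filter (fun c => c i = 0) ∪ Finset.image₂ comb P N)
      (by
        intro c hc
        rcases Finset.mem_union.1 hc with hc | hc
        · rw [Finset.mem_filter] at hc
          exact hsupp c (hF c hc.1) hc.2
        · obtain ⟨c, hcP, d, hd, rfl⟩ := Finset.mem_image₂.1 hc
          refine hsupp _ ?_ ?_
          · refine Finsupp.support_add.trans (Finset.union_subset ?_ ?_)
            · exact Finsupp.support_smul.trans (hF c (hP c hcP).1)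
            · exact Finsupp.support_smul.trans (hF d (hN d hd).1)
          · simp only [comb, Finsupp.add_apply, Finsupp.smul_apply, smul_eq_mul]
            ring)
      (by
        intro c hc
        rcases Finset.mem_union.1 hc with hc | hc
        · exact hx c (Finset.mem_filter.1 hc).1
        · obtain ⟨c, hcP, d, hd, rfl⟩ := Finset.mem_image₂.1 hc
          rw [hcomb]
          exact add_nonneg (smul_nonneg (neg_nonneg.2 (hN d hd).2.le) (hx c (hP c hcP).1))
            (smul_nonneg (hP c hcP).2.le (hx d (hN d hd).1)))
    have hA : ∀ d : ι →₀ R, d i < 0 → 0 < -algebraMap R ℝ (d i) := fun d hd => by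
      rw [← map_neg]
      exact hR _ (neg_pos.2 hd)
    have hpair : ∀ c ∈ P, ∀ d ∈ N, comb c d ∈
        F.filter (fun c => c i = 0) ∪ Finset.image₂ comb P N := fun c hc d hd =>
      Finset.mem_union_right _ (Finset.mem_image₂_of_mem hc hd)
    -- The bound that `c` puts on coordinate `i`: a lower bound if `c i > 0`, an upper one if `c i <
    -- 0`. The inequality `comb c d` says exactly `l c ≤ l d`.
    let l : (ι →₀ R) → ℝ := fun c => -linearCombination R y c / algebraMap R ℝ (c i)
    have hld : ∀ d : ι →₀ R, l d = linearCombination R y d / -algebraMap R ℝ (d i) := fun d => by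
      rw [div_neg, ← neg_div]
    obtain ⟨t, htP, htN⟩ := exists_real_between P N l (by
      intro c hc d hd
      have h := (hy _ (hpair c hc d hd)).1
      rw [hcombR, Algebra.smul_def, Algebra.smul_def, map_neg] at h
      rw [hld d, div_le_div_iff₀ (hR _ (hP c hc).2) (hA d (hN d hd).2)]
      linarith)
    have hlt : ∀ c ∈ P, ∀ d ∈ N, 0 < linearCombination R x (comb c d) → l c < l d := by
      intro c hc d hd hlt
      have h := (hy _ (hpair c hc d hd)).2 hlt
      rw [hcombR, Algebra.smul_def, Algebra.smul_def, map_neg] at h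
      rw [hld d, div_lt_div_iff₀ (hR _ (hP c hc).2) (hA d (hN d hd).2)]
      linarith
    refine ⟨fun j => y j + if j = i then t else 0, fun c hc => ?_⟩
    rw [linearCombination_add_single, Algebra.smul_def]
    rcases lt_trichotomy (c i) 0 with h | h | h
    · have hcN : c ∈ N := Finset.mem_filter.2 ⟨hc, h⟩
      have h1 := htN c hcN
      rw [hld, le_div_iff₀ (hA c h), lt_div_iff₀ (hA c h)] at h1
      refine ⟨by linarith [h1.1], fun hpos => ?_⟩
      -- If `c` is strict at `x`, then so is its combination with every opposite inequality. All
      -- opposing bounds are then strictly separated from `l c`, and `t` avoids `l c`.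
      have h2 := h1.2 fun d hd => by
        rw [← hld]
        refine hlt d hd c hcN ?_
        rw [hcomb]
        exact add_pos_of_nonneg_of_pos
          (smul_nonneg (neg_nonneg.2 h.le) (hx d (hP d hd).1)) (smul_pos (hP d hd).2 hpos)
      linarith
    · rw [h, map_zero, zero_mul, add_zero]
      exact hy c (Finset.mem_union_left _ (Finset.mem_filter.2 ⟨hc, h⟩))
    · have hcP : c ∈ P := Finset.mem_filter.2 ⟨hc, h⟩
      have h1 := htP c hcP
      simp only [l] at h1
      rw [div_le_iff₀ (hR _ h), div_lt_iff₀ (hR _ h)] at h1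
      refine ⟨by linarith [h1.1], fun hpos => ?_⟩
      have h2 := h1.2 fun d hd => by
        refine hlt c hcP d hd ?_
        rw [hcomb]
        exact add_pos_of_pos_of_nonneg
          (smul_pos (neg_pos.2 (hN d hd).2) hpos) (smul_nonneg h.le (hx d (hN d hd).1))
      linarith

end FourierMotzkin
end RieszMV

/-! ### Linear pieces of formulas and Chang's completeness theorem -/

namespace RieszMV
open MVAlgebra

/-- The evaluation in the standard Riesz MV-algebra that extends a valuation of the variables. -/
noncomputable def RForm.eval (v : ℕ → unitInterval) : RForm → unitInterval
  | .var n => v n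
  | .neg φ => star (φ.eval v)
  | .imp φ ψ => oplus (star (φ.eval v)) (ψ.eval v)
  | .nabla r φ => star (RieszMVAlgebra.smul r (star (φ.eval v)))

theorem RForm.isEvaluation_eval (v : ℕ → unitInterval) : IsEvaluation (RForm.eval v) :=
  ⟨fun _ _ => rfl, fun _ => rfl, fun _ _ => rfl⟩

/-- The valuation in `[0,1]` obtained by rescaling the point `y`, whose coordinate `none` is the
unit. -/
noncomputable def valuation (y : Option ℕ → ℝ) (n : ℕ) : unitInterval :=
  Set.projIcc 0 1 zero_le_one (y (some n) / y none)

/-- The value of a formula in the real interval `[0, y none]`. -/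
noncomputable def RForm.scaledEval (φ : RForm) (y : Option ℕ → ℝ) : ℝ :=
  y none * (φ.eval (valuation y) : ℝ)

open Finsupp (single linearCombination linearCombination_single)

section Tracks

variable (R : Type*) [CommRing R] [Algebra R ℝ]
  {G : Type*} [AddCommGroup G] [LinearOrder G] [Module R G]
  {x : Option ℕ → G} {a b : G} {φ ψ : RForm}

/-- Finitely many linear inequalities that hold at `x` force the value of `φ` to be given by a
linear form, whose value at `x` is `a`. -/
def Tracks (x : Option ℕ → G) (a : G) (φ : RForm) : Prop :=
  ∃ (F : Finset (Option ℕ →₀ R)) (l : Option ℕ →₀ R),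
    (∀ c ∈ F, 0 ≤ linearCombination R x c) ∧ linearCombination R x l = a ∧
    ∀ y : Option ℕ → ℝ, 0 < y none → (∀ c ∈ F, 0 ≤ linearCombination R y c) →
      φ.scaledEval y = linearCombination R y l

variable {R}

theorem Tracks.neg (h : Tracks R x a φ) : Tracks R x (x none - a) φ.neg := by
  obtain ⟨F, l, hF, hl, hy⟩ := h
  refine ⟨F, single none 1 - l, hF, by simp [hl], fun y hy0 hyF => ?_⟩
  rw [map_sub, ← hy y hy0 hyF]
  simp only [RForm.scaledEval, RForm.eval, linearCombination_single, one_smul]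
  change _ * (1 - _) = _
  ring

theorem Tracks.nabla (h : Tracks R x a φ) (c : R) (r : unitInterval)
    (hc : algebraMap R ℝ c = r) :
    Tracks R x (x none - c • (x none - a)) (.nabla r φ) := by
  obtain ⟨F, l, hF, hl, hy⟩ := h
  refine ⟨F, single none 1 - c • (single none 1 - l), hF, by simp [hl], fun y hy0 hyF => ?_⟩
  rw [map_sub, map_smul, map_sub, ← hy y hy0 hyF, Algebra.smul_def, hc]
  simp only [RForm.scaledEval, RForm.eval, linearCombination_single, one_smul]
  change _ * (1 - (r : ℝ) * (1 - _)) = _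
  ring

variable [IsOrderedAddMonoid G]

open Classical in
-- The two inequalities ensure that the projection onto `[0,1]` in `valuation` does not alter the
-- coordinate.
theorem Tracks.var {n : ℕ} (h : 0 ≤ x (some n)) (h' : x (some n) ≤ x none) :
    Tracks R x (x (some n)) (.var n) := by
  refine ⟨{single (some n) 1, single none 1 - single (some n) 1}, single (some n) 1, ?_,
    by simp, fun y hy hF => ?_⟩
  · simpa using ⟨h, h'⟩
  · have h1 : 0 ≤ y (some n) ∧ y (some n) ≤ y none := by simpa using hF
    have h2 : y (some n) / y none ∈ Set.Icc (0 : ℝ) 1 :=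
      ⟨div_nonneg h1.1 hy.le, (div_le_one hy).2 h1.2⟩
    simp only [RForm.scaledEval, RForm.eval, valuation, linearCombination_single, one_smul]
    rw [Set.projIcc_of_mem _ h2]
    field_simp

open Classical in
-- The implication has two linear pieces, separated by the comparison of premise and conclusion. The
-- comparison that holds between `a` and `b` is added to the inequalities.
theorem Tracks.imp (h : Tracks R x a φ) (h' : Tracks R x b ψ) :
    Tracks R x (min (x none) (x none - a + b)) (φ.imp ψ) := by
  obtain ⟨F, l, hF, hl, hy⟩ := h
  obtain ⟨F', l', hF', hl', hy'⟩ := h'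
  have key : ∀ y : Option ℕ → ℝ, 0 < y none → (φ.imp ψ).scaledEval y =
      min (y none) (y none - φ.scaledEval y + ψ.scaledEval y) := fun y hy0 => by
    simp only [RForm.scaledEval, RForm.eval]
    change _ * min 1 (1 - _ + _) = _
    rw [mul_min_of_nonneg _ _ hy0.le]
    ring_nf
  rcases le_total a b with hab | hab
  · refine ⟨F ∪ F' ∪ {l' - l}, single none 1, ?_, ?_, fun y hy0 hyF => ?_⟩
    · simp only [Finset.mem_union, Finset.mem_singleton]
      rintro c ((hc | hc) | rfl)
      · exact hF c hc
      · exact hF' c hc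
      · rw [map_sub, hl, hl']
        exact sub_nonneg.2 hab
    · rw [linearCombination_single, one_smul, min_eq_left]
      rw [sub_add, le_sub_self_iff]
      exact sub_nonpos.2 hab
    · simp only [Finset.mem_union, Finset.mem_singleton] at hyF
      have h1 := hyF _ (.inr rfl)
      rw [map_sub, ← hy y hy0 fun c hc => hyF c (.inl (.inl hc)),
        ← hy' y hy0 fun c hc => hyF c (.inl (.inr hc))] at h1
      rw [key y hy0, linearCombination_single, one_smul, min_eq_left]
      linarith
  · refine ⟨F ∪ F' ∪ {l - l'}, single none 1 - l + l', ?_, ?_, fun y hy0 hyF => ?_⟩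
    · simp only [Finset.mem_union, Finset.mem_singleton]
      rintro c ((hc | hc) | rfl)
      · exact hF c hc
      · exact hF' c hc
      · rw [map_sub, hl, hl']
        exact sub_nonneg.2 hab
    · rw [map_add, map_sub, hl, hl', linearCombination_single, one_smul, min_eq_right]
      rw [sub_add, sub_le_self_iff]
      exact sub_nonneg.2 hab
    · simp only [Finset.mem_union, Finset.mem_singleton] at hyF
      have h1 := hyF _ (.inr rfl)
      rw [map_sub] at h1
      rw [map_add, map_sub, linearCombination_single, one_smul]
      rw [← hy y hy0 fun c hc => hyF c (.inl (.inl hc)),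
        ← hy' y hy0 fun c hc => hyF c (.inl (.inr hc))] at h1 ⊢
      rw [key y hy0, min_eq_right]
      linarith

open Classical in
/-- A formula that takes a value below the unit in a totally ordered module is not a standard
tautology. -/
theorem Tracks.exists_eval_ne_one [LinearOrder R] [IsStrictOrderedRing R] [PosSMulStrictMono R G]
    (hR : ∀ c : R, 0 < c → 0 < algebraMap R ℝ c) (h : Tracks R x a φ) (h0 : 0 < x none)
    (ha : a < x none) : ∃ v, φ.eval v ≠ 1 := by
  obtain ⟨F, l, hF, hl, hy⟩ := h
  -- The added forms are strict at `x`: one keeps the unit positive, so that rescaling is possible,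
  -- and the other keeps the formula below the unit.
  let F' := F ∪ {single none 1, single none 1 - l}
  obtain ⟨y, hyF⟩ := exists_real_solution hR x (F'.biUnion Finsupp.support) F'
    (fun c hc => Finset.subset_biUnion_of_mem Finsupp.support hc) (by
      simp only [F', Finset.mem_union, Finset.mem_insert, Finset.mem_singleton]
      rintro c (hc | rfl | rfl)
      · exact hF c hc
      · simpa using h0.le
      · rw [map_sub, hl]
        simpa using ha.le)
  simp only [F', Finset.mem_union, Finset.mem_insert, Finset.mem_singleton] at hyF
  have hy0 : 0 < y none := by
    simpa using (hyF _ (.inr (.inl rfl))).2 (by simpa using h0)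
  have hlt : linearCombination R y l < y none := by
    simpa using (hyF _ (.inr (.inr rfl))).2 (by simpa [hl] using ha)
  refine ⟨valuation y, fun h1 => ?_⟩
  rw [← hy y hy0 fun c hc => (hyF c (.inl hc)).1, RForm.scaledEval, h1] at hlt
  simp at hlt

end Tracks

theorem LForm.isTheory : IsTheory LForm.neg LForm.imp {φ | φ.Provable} where
  a1 _ _ := .ax (.a1 _ _)
  a2 _ _ _ := .ax (.a2 _ _ _)
  a3 _ _ := .ax (.a3 _ _)
  a4 _ _ := .ax (.a4 _ _)
  mp := .mp

theorem RForm.isTheory : IsTheory RForm.neg RForm.imp {φ | φ.Provable} where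
  a1 _ _ := .ax (.a1 _ _)
  a2 _ _ _ := .ax (.a2 _ _ _)
  a3 _ _ := .ax (.a3 _ _)
  a4 _ _ := .ax (.a4 _ _)
  mp := .mp

instance : Inhabited LForm := ⟨.var 0⟩

instance : Inhabited RForm := ⟨.var 0⟩

/-- The point of Chang's group given by the values of the variables, together with the unit. -/
noncomputable def changPoint {C : Type u} [MVAlgebra C] [IsMVChain C] (v : ℕ → C) :
    Option ℕ → ChangGroup C
  | none => ChangGroup.unit C
  | some n => ChangGroup.of (v n)

namespace ChangGroup

variable {C : Type u} [MVAlgebra C] [hC : IsMVChain C]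

theorem unit_pos : 0 < unit C := by
  rw [← of_one, ← of_zero]
  exact lt_of_le_of_ne (of_zero (C := C) ▸ of_nonneg _) fun h => hC.zero_ne_one (of_injective h)

theorem of_lt_unit {a : C} (h : a ≠ one) : of a < unit C :=
  lt_of_le_of_ne (of_le_unit a) fun h' => h (of_injective (h'.trans of_one.symm))

theorem of_imp (a b : C) : of (oplus (star a) b) = min (unit C) (unit C - of a + of b) := by
  rw [of_oplus, of_star]

end ChangGroup

/-- Chang's completeness theorem. -/
theorem LForm.provable_of_eval {φ : LForm} (h : ∀ v, φ.toRForm.eval v = 1) : φ.Provable := by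
  by_contra hφ
  obtain ⟨C, _, _, e, -, himp, hneg, -, hne⟩ := LForm.isTheory.exists_chain hφ
  have key : ∀ ψ : LForm, Tracks ℤ (changPoint fun n => e (.var n)) (ChangGroup.of (e ψ))
      ψ.toRForm := fun ψ => by
    induction ψ with
    | var n => exact .var (ChangGroup.of_nonneg _) (ChangGroup.of_le_unit _)
    | neg ψ ih =>
      rw [hneg, ChangGroup.of_star]
      exact ih.neg
    | imp ψ χ ih ih' =>
      rw [himp, ChangGroup.of_imp]
      exact ih.imp ih'
  obtain ⟨v, hv⟩ := (key φ).exists_eval_ne_one (fun c hc => by simpa using hc)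
    ChangGroup.unit_pos (ChangGroup.of_lt_unit hne)
  exact hv (h v)

end RieszMV

/-! ### The real module structure on the group of a Riesz MV-chain -/

namespace RieszMV
open MVAlgebra

namespace RieszMVAlgebra

variable {C : Type u} [RieszMVAlgebra C]

theorem odot_star_self {A : Type*} [MVAlgebra A] (x : A) : odot x (star x) = zero :=
  odot_star_eq_zero_iff.2 (Le.refl x)

theorem smul_zero (r : unitInterval) : smul r (zero : C) = zero := by
  rw [← odot_star_self (zero : C), smul_odot_star, odot_star_self, odot_star_self]

theorem odot_star_eq {r q t : unitInterval} (h : (t : ℝ) = r + q) : odot t (star q) = r := by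
  apply Subtype.ext
  rw [coe_odot_star, h, add_sub_cancel_right, max_eq_right r.2.1]

open ChangGroup

variable [IsMVChain C]

theorem odot_star_eq_of_add {a b c : C} (h : of c = of a + of b) : odot c (star b) = a := by
  apply of_injective
  rw [of_odot_star, h, add_sub_cancel_right, max_eq_right (of_nonneg a)]

theorem of_eq_add {a b c : C} (h : odot c (star b) = a) (h' : odot b (star c) = zero) :
    of c = of a + of b := by
  have h1 : of b ≤ of c := by
    have h2 := congrArg of h'
    rw [of_odot_star, of_zero] at h2
    exact sub_nonpos.1 (max_eq_left_iff.1 h2)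
  rw [← h, of_odot_star, max_eq_right (sub_nonneg.2 h1), sub_add_cancel]

/-- An overflow-free sum `c = a + b` is expressed by the truncated differences `c ⊙ ∼b = a` and `b ⊙
∼c = 0`, which scalar multiplication preserves. -/
theorem of_smul_add (r : unitInterval) {a b c : C} (h : of c = of a + of b) :
    of (smul r c) = of (smul r a) + of (smul r b) := by
  have h1 : odot b (star c) = zero := by
    apply of_injective
    rw [of_odot_star, of_zero, max_eq_left]
    rw [h, sub_nonpos]
    exact le_add_of_nonneg_left (of_nonneg a)
  apply of_eq_add
  · rw [← smul_odot_star, odot_star_eq_of_add h]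
  · rw [← smul_odot_star, h1, smul_zero]

theorem of_add_smul {r q t : unitInterval} (h : (t : ℝ) = r + q) (a : C) :
    of (smul t a) = of (smul r a) + of (smul q a) := by
  apply of_eq_add
  · rw [← odot_star_smul, odot_star_eq h]
  · have h0 : odot q (star t) = odot (0 : unitInterval) (star 0) := by
      apply Subtype.ext
      rw [coe_odot_star, coe_odot_star, h, max_eq_left (by linarith [r.2.1]), sub_self, max_self]
    rw [← odot_star_smul, h0, odot_star_smul, odot_star_self]

/-- The action of a scalar of the unit interval on Chang's group. -/
noncomputable def smulHom (r : unitInterval) : ChangGroup C →+ ChangGroup C :=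
  lift (fun a => of (smul r a)) fun _ _ _ h => of_smul_add r h

theorem smulHom_of (r : unitInterval) (a : C) : smulHom r (of a) = of (smul r a) := lift_of _ _ a

end RieszMVAlgebra

theorem real_hom_ext {H : Type*} [AddCommGroup H] {f f' : ℝ →+ H}
    (h : ∀ r : unitInterval, f r = f' r) : f = f' := by
  ext r
  have h1 := h 1
  have h2 := h ⟨Int.fract r, Int.fract_nonneg r, (Int.fract_lt_one r).le⟩
  simp only [Set.Icc.coe_one] at h1 h2
  rw [← Int.floor_add_fract r, map_add, map_add, h2, ← zsmul_one, map_zsmul, map_zsmul, h1]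

/-- A map on the unit interval that preserves the sums without overflow extends to an additive
map on the real numbers. -/
theorem exists_real_hom {H : Type*} [AddCommGroup H] (f : unitInterval → H)
    (hf : ∀ r q t : unitInterval, (t : ℝ) = r + q → f t = f r + f q) :
    ∃ F : ℝ →+ H, ∀ r : unitInterval, F r = f r := by
  let φ : ℝ → unitInterval := fun r => ⟨Int.fract r, Int.fract_nonneg r, (Int.fract_lt_one r).le⟩
  have hφ : ∀ r, (φ r : ℝ) = r - ⌊r⌋ := fun r => rfl
  have hφ1 : ∀ r, (φ r : ℝ) < 1 := fun r => Int.fract_lt_one r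
  refine ⟨AddMonoidHom.mk' (fun r => ⌊r⌋ • f 1 + f (φ r)) fun r q => ?_, fun r => ?_⟩
  · have hr := hφ r
    have hq := hφ q
    have hrq := hφ (r + q)
    have r1 := hφ1 r
    have q1 := hφ1 q
    have r0 := (φ r).2.1
    have q0 := (φ q).2.1
    rcases lt_or_ge ((φ r : ℝ) + φ q) 1 with h | h
    · have e : ⌊r + q⌋ = ⌊r⌋ + ⌊q⌋ := by
        rw [Int.floor_eq_iff]
        push_cast
        constructor <;> linarith
      rw [e] at hrq
      push_cast at hrq
      rw [e, hf (φ r) (φ q) (φ (r + q)) (by linarith), add_smul]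
      abel
    · have e : ⌊r + q⌋ = ⌊r⌋ + ⌊q⌋ + 1 := by
        rw [Int.floor_eq_iff]
        push_cast
        constructor <;> linarith
      rw [e] at hrq
      push_cast at hrq
      -- With `t = 1 - φ q`, both `1 = t + φ q` and `φ r = φ (r + q) + t` are sums within the unit
      -- interval, and they account for the carry.
      let t : unitInterval := ⟨1 - φ q, by linarith, by linarith⟩
      have h1 : f 1 = f t + f (φ q) := hf _ _ _ (by simp [t])
      have h2 : f (φ r) = f (φ (r + q)) + f t := hf _ _ _ (by simp only [t]; linarith)
      rw [e, h2]
      simp only [add_smul, one_smul]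
      nth_rewrite 3 [h1]
      abel
  · have h0 : f 0 = 0 := left_eq_add.1 (hf 0 0 0 (by simp))
    change ⌊(r : ℝ)⌋ • f 1 + f (φ r) = f r
    rcases eq_or_lt_of_le r.2.2 with h | h
    · have hr : r = 1 := Subtype.ext h
      have e : φ (1 : unitInterval) = 0 := Subtype.ext (by simp [φ])
      rw [hr, e, h0]
      simp
    · have e : ⌊(r : ℝ)⌋ = 0 := Int.floor_eq_zero_iff.2 ⟨r.2.1, h⟩
      have e' : φ r = r := Subtype.ext (by rw [hφ, e, Int.cast_zero, sub_zero])
      rw [e, e', zero_smul, zero_add]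

namespace ChangGroup

open RieszMVAlgebra

variable {C : Type u} [RieszMVAlgebra C] [IsMVChain C]

theorem exists_scalar_action (C : Type u) [RieszMVAlgebra C] [IsMVChain C] :
    ∃ F : ℝ →+ AddMonoid.End (ChangGroup C), ∀ r : unitInterval, F r = smulHom r :=
  exists_real_hom (H := AddMonoid.End (ChangGroup C)) smulHom fun r q t h =>
    hom_ext fun a => by
      change smulHom t (of a) = smulHom r (of a) + smulHom q (of a)
      rw [smulHom_of, smulHom_of, smulHom_of, of_add_smul h]

/-- The action of the real numbers on the group of a totally ordered Riesz MV-algebra. -/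
noncomputable def scalarAction (C : Type u) [RieszMVAlgebra C] [IsMVChain C] :
    ℝ →+ AddMonoid.End (ChangGroup C) := (exists_scalar_action C).choose

theorem scalarAction_of (r : unitInterval) (a : C) :
    scalarAction C r (of a) = of (smul r a) := by
  rw [scalarAction, (exists_scalar_action C).choose_spec r]
  exact smulHom_of r a

theorem scalarAction_one : scalarAction C 1 = 1 := hom_ext fun a => by
  have h := scalarAction_of 1 a
  rw [RieszMVAlgebra.one_smul] at h
  exact h

/-- Both sides are additive in each scalar, so the identity passes from the unit interval to all
reals, first in `r` and then in `q`. -/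
theorem scalarAction_mul (r q : ℝ) :
    scalarAction C (r * q) = scalarAction C r * scalarAction C q := by
  have h1 : ∀ q : unitInterval, (scalarAction C).comp (AddMonoidHom.mulRight (q : ℝ)) =
      (AddMonoidHom.mulRight (scalarAction C q)).comp (scalarAction C) := fun q =>
    real_hom_ext fun r => hom_ext fun a => by
      change scalarAction C (r * q) (of a) = scalarAction C r (scalarAction C q (of a))
      rw [← Set.Icc.coe_mul, scalarAction_of, scalarAction_of, scalarAction_of,
        RieszMVAlgebra.smul_smul]
  have h2 : (scalarAction C).comp (AddMonoidHom.mulLeft r) =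
      (AddMonoidHom.mulLeft (scalarAction C r)).comp (scalarAction C) :=
    real_hom_ext fun q => DFunLike.congr_fun (h1 q) r
  exact DFunLike.congr_fun h2 q

noncomputable instance : Module ℝ (ChangGroup C) where
  smul r g := scalarAction C r g
  one_smul g := DFunLike.congr_fun scalarAction_one g
  mul_smul r q g := DFunLike.congr_fun (scalarAction_mul r q) g
  smul_zero r := map_zero (scalarAction C r)
  smul_add r := map_add (scalarAction C r)
  add_smul r q g := DFunLike.congr_fun (map_add (scalarAction C) r q) g
  zero_smul g := DFunLike.congr_fun (map_zero (scalarAction C)) g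

theorem smul_of (r : unitInterval) (a : C) : (r : ℝ) • of a = of (smul r a) :=
  scalarAction_of r a

theorem real_smul_nonneg {r : ℝ} (hr : 0 ≤ r) {g : ChangGroup C} (hg : 0 ≤ g) : 0 ≤ r • g := by
  have key : ∀ a : C, 0 ≤ r • of a := fun a => by
    have h := smul_of ⟨Int.fract r, Int.fract_nonneg r, (Int.fract_lt_one r).le⟩ a
    simp only at h
    rw [← Int.floor_add_fract r, add_smul, h, Int.cast_smul_eq_zsmul]
    exact add_nonneg (zsmul_nonneg (of_nonneg a) (Int.floor_nonneg.2 hr)) (of_nonneg _)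
  rw [← eq_zsmul_add g, smul_add, smul_comm, ← of_one]
  exact add_nonneg (zsmul_nonneg (key _) (nonneg_iff.1 hg)) (key _)

instance : PosSMulStrictMono ℝ (ChangGroup C) :=
  haveI : PosSMulMono ℝ (ChangGroup C) := .of_smul_nonneg fun _ hr _ hg => real_smul_nonneg hr hg
  PosSMulMono.toPosSMulStrictMono

end ChangGroup
end RieszMV

/-! ### Soundness, the Riesz structure on Lindenbaum chains, and completeness -/

namespace RieszMV
open MVAlgebra

local infixl:65 " ⊹ " => oplus
local prefix:max "∼" => MVAlgebra.star

namespace MVAlgebra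

variable {A : Type*} [MVAlgebra A]

theorem odot_star (x y : A) : odot x (∼y) = ∼(∼x ⊹ y) := by rw [odot, MVAlgebra.star_star]

theorem le_or_right (x y : A) : Le y (∼(∼x ⊹ y) ⊹ y) := by
  rw [oplus_comm]
  exact le_oplus_right _ _

theorem le_or_left (x y : A) : Le x (∼(∼x ⊹ y) ⊹ y) := by
  rw [luk]
  exact le_or_right y x

theorem imp_trans (x y z : A) : Le (∼x ⊹ y) (∼(∼y ⊹ z) ⊹ (∼x ⊹ z)) := by
  rw [oplus_left_comm]
  exact (le_or_left y z).oplus_left _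

theorem and_eq_one_iff (x y : A) : ∼(∼(∼(∼x) ⊹ ∼y) ⊹ ∼y) = one ↔ x = one ∧ y = one := by
  constructor
  · intro h
    have h0 : ∼(∼(∼x) ⊹ ∼y) ⊹ ∼y = zero := star_injective h
    have hx := le_or_left (∼x) (∼y)
    have hy := le_or_right (∼x) (∼y)
    rw [h0] at hx hy
    exact ⟨star_injective ((eq_zero_of_le_zero hx).trans MVAlgebra.star_one.symm),
      star_injective ((eq_zero_of_le_zero hy).trans MVAlgebra.star_one.symm)⟩
  · rintro ⟨rfl, rfl⟩
    rw [star_oplus_self, MVAlgebra.star_one, zero_oplus]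
    rfl

end MVAlgebra

/-- A map on formulas that respects negation and implication sends an equivalence to `1` exactly
when it identifies its two sides. -/
theorem RForm.iff_eq_one_iff {A : Type*} [MVAlgebra A] {e : RForm → A}
    (himp : ∀ φ ψ, e (φ.imp ψ) = ∼(e φ) ⊹ e ψ) (hneg : ∀ φ, e φ.neg = ∼(e φ)) (φ ψ : RForm) :
    e (φ.iff ψ) = one ↔ e φ = e ψ := by
  simp only [RForm.iff, RForm.and, RForm.or, himp, hneg, and_eq_one_iff]
  exact ⟨fun h => Le.antisymm h.1 h.2, fun h => by
    rw [h, star_oplus_self]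
    exact ⟨rfl, rfl⟩⟩

/-- Soundness. -/
theorem RForm.Provable.eval_eq_one {φ : RForm} (h : φ.Provable) {R : Type*} [RieszMVAlgebra R]
    {e : RForm → R} (he : IsEvaluation e) : e φ = one := by
  induction h with
  | ax h =>
    have hiff := RForm.iff_eq_one_iff he.map_imp he.map_neg
    cases h with
    | a1 φ ψ =>
      rw [he.map_imp, he.map_imp, oplus_comm (∼(e ψ))]
      exact le_oplus_right _ _
    | a2 φ ψ χ =>
      simp only [he.map_imp]
      exact imp_trans _ _ _
    | a3 φ ψ =>
      simp only [he.map_imp]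
      rw [luk]
      exact Le.refl _
    | a4 φ ψ =>
      simp only [he.map_imp, he.map_neg]
      rw [MVAlgebra.star_star, oplus_comm (∼(e ψ))]
      exact Le.refl _
    | rl1 r φ ψ =>
      rw [hiff]
      simp only [he.map_imp, he.map_nabla]
      -- ∇ is dual to scalar multiplication, so the axiom is applied to the complements, whose
      -- truncated difference is the complement of the implication.
      have h := RieszMVAlgebra.smul_odot_star r (∼(e ψ)) (∼(e φ))
      rw [odot_star, odot_star, MVAlgebra.star_star, oplus_comm (e ψ)] at h
      rw [h, MVAlgebra.star_star, MVAlgebra.star_star, oplus_comm]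
    | rl2 r q φ =>
      rw [hiff]
      simp only [he.map_imp, he.map_nabla]
      rw [RieszMVAlgebra.odot_star_smul, odot_star, MVAlgebra.star_star, MVAlgebra.star_star,
        oplus_comm]
    | rl3 r q φ =>
      rw [hiff]
      simp only [he.map_nabla]
      rw [MVAlgebra.star_star, RieszMVAlgebra.smul_smul]
    | rl4 φ =>
      rw [hiff, he.map_nabla, RieszMVAlgebra.one_smul, MVAlgebra.star_star]
  | mp _ _ ih ih' =>
    rw [he.map_imp, ih', MVAlgebra.star_one, zero_oplus] at ih
    exact ih

/-- An unprovable formula is refuted by an evaluation in a totally ordered Riesz MV-algebra. -/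
theorem RForm.exists_evaluation_ne_one {φ : RForm} (hφ : ¬ φ.Provable) :
    ∃ (C : Type) (_ : RieszMVAlgebra C) (_ : IsMVChain C) (e : RForm → C),
      IsEvaluation e ∧ e φ ≠ one := by
  obtain ⟨C, iC, hC, e, hsurj, himp, hneg, hone, hne⟩ := RForm.isTheory.exists_chain hφ
  have hiff : ∀ {ψ χ : RForm}, IsAxiom (ψ.iff χ) → e ψ = e χ := fun h =>
    (RForm.iff_eq_one_iff himp hneg _ _).1 (hone _ (.ax h))
  -- The weakening axiom `a1` with `rl2` and `rl4` gives `ψ → ∇_{1-q} ψ`. Necessitation for ∇ is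
  -- thus derived from modus ponens alone, and with `rl1` it makes ∇ well defined on classes.
  have hle : ∀ (q : unitInterval) (ψ : RForm), Le (e ψ) (e (.nabla (odot 1 (star q)) ψ)) :=
    fun q ψ => by
      have h := hone _ (.ax (.a1 (.nabla 1 ψ) (.nabla q ψ)))
      rwa [himp, ← hiff (.rl2 1 q ψ), hiff (.rl4 ψ)] at h
  have hnec : ∀ (r : unitInterval) {ψ : RForm}, e ψ = one → e (.nabla r ψ) = one :=
    fun r ψ h => by
      have hr : odot 1 (star (star r)) = r := by
        apply Subtype.ext
        rw [coe_odot_star]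
        change max 0 (1 - (1 - (r : ℝ))) = r
        rw [sub_sub_cancel, max_eq_right r.2.1]
      have h1 := hle (star r) ψ
      rw [hr, h] at h1
      exact eq_one_of_one_le h1
  have hcongr : ∀ (r : unitInterval) {ψ χ : RForm}, e ψ = e χ → e (.nabla r ψ) = e (.nabla r χ) :=
    fun r ψ χ h => by
      have key : ∀ {ψ χ : RForm}, e ψ = e χ → Le (e (.nabla r ψ)) (e (.nabla r χ)) :=
        fun {ψ χ} h => by
          rw [Le, ← himp, ← hiff (.rl1 r ψ χ)]
          exact hnec r (by rw [himp, h, star_oplus_self])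
      exact (key h).antisymm (key h.symm)
  let out := Function.surjInv hsurj
  have hout : ∀ x, e (out x) = x := Function.surjInv_eq hsurj
  let sm : unitInterval → C → C := fun r x => ∼(e (.nabla r (out x).neg))
  have hsm : ∀ r ψ, sm r (e ψ) = ∼(e (.nabla r ψ.neg)) := fun r ψ =>
    congrArg _ (hcongr r (by rw [hneg, hneg, hout]))
  let iR : RieszMVAlgebra C :=
    { iC with
      smul := sm
      smul_odot_star := fun r x y => by
        obtain ⟨ψ, rfl⟩ := hsurj x
        obtain ⟨χ, rfl⟩ := hsurj y
        have h1 : odot (e ψ) (∼(e χ)) = e (RForm.imp χ.neg ψ.neg).neg := by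
          rw [hneg, himp, hneg, hneg, MVAlgebra.star_star, odot_star, oplus_comm]
        have h2 : e (RForm.imp χ.neg ψ.neg).neg.neg = e (RForm.imp χ.neg ψ.neg) := by
          rw [hneg, hneg, MVAlgebra.star_star]
        rw [h1, hsm, hsm, hsm, hcongr r h2, hiff (.rl1 r χ.neg ψ.neg), himp, odot_star,
          MVAlgebra.star_star, oplus_comm]
      odot_star_smul := fun r q x => by
        obtain ⟨ψ, rfl⟩ := hsurj x
        rw [hsm, hsm, hsm, hiff (.rl2 r q ψ.neg), himp, odot_star, MVAlgebra.star_star,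
          oplus_comm]
      smul_smul := fun r q x => by
        obtain ⟨ψ, rfl⟩ := hsurj x
        rw [hsm q, ← hneg, hsm, hsm, ← hiff (.rl3 r q ψ.neg)]
        exact congrArg _ (hcongr r (by rw [hneg, hneg, MVAlgebra.star_star]))
      one_smul := fun x => by
        obtain ⟨ψ, rfl⟩ := hsurj x
        rw [hsm, hiff (.rl4 ψ.neg), hneg, MVAlgebra.star_star] }
  refine ⟨C, iR, hC, e, ⟨himp, hneg, fun r ψ => ?_⟩, hne⟩
  change _ = ∼(sm r (∼(e ψ)))
  rw [← hneg, hsm, MVAlgebra.star_star]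
  exact hcongr r (by rw [hneg, hneg, MVAlgebra.star_star])

/-- Completeness with respect to the standard Riesz MV-algebra. -/
theorem RForm.provable_of_eval {φ : RForm} (h : ∀ v, φ.eval v = 1) : φ.Provable := by
  by_contra hφ
  obtain ⟨C, _, _, e, he, hne⟩ := RForm.exists_evaluation_ne_one hφ
  have key : ∀ ψ : RForm, Tracks ℝ (changPoint fun n => e (.var n)) (ChangGroup.of (e ψ)) ψ :=
    fun ψ => by
      induction ψ with
      | var n => exact .var (ChangGroup.of_nonneg _) (ChangGroup.of_le_unit _)
      | neg ψ ih =>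
        rw [he.map_neg, ChangGroup.of_star]
        exact ih.neg
      | imp ψ χ ih ih' =>
        rw [he.map_imp, ChangGroup.of_imp]
        exact ih.imp ih'
      | nabla r ψ ih =>
        rw [he.map_nabla, ChangGroup.of_star, ← ChangGroup.smul_of, ChangGroup.of_star]
        exact ih.nabla r r rfl
  obtain ⟨v, hv⟩ := (key φ).exists_eval_ne_one (fun c hc => hc)
    ChangGroup.unit_pos (ChangGroup.of_lt_unit hne)
  exact hv (h v)

theorem one_eq_one : (MVAlgebra.one : unitInterval) = 1 := Subtype.ext (sub_zero 1)

theorem LForm.Provable.toRForm {φ : LForm} (h : φ.Provable) : φ.toRForm.Provable := by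
  induction h with
  | ax h =>
    refine .ax ?_
    cases h
    exacts [.a1 _ _, .a2 _ _ _, .a3 _ _, .a4 _ _]
  | mp _ _ ih ih' => exact .mp ih ih'

/-- The copy in an arbitrary universe of a Riesz MV-algebra. -/
instance {R : Type*} [RieszMVAlgebra R] : RieszMVAlgebra (ULift.{u} R) where
  oplus x y := ⟨x.down ⊹ y.down⟩
  star x := ⟨∼x.down⟩
  zero := ⟨zero⟩
  oplus_assoc _ _ _ := congrArg ULift.up (oplus_assoc _ _ _)
  oplus_comm _ _ := congrArg ULift.up (oplus_comm _ _)
  zero_oplus _ := congrArg ULift.up (zero_oplus _)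
  star_star _ := congrArg ULift.up (MVAlgebra.star_star _)
  star_zero_oplus _ := congrArg ULift.up (star_zero_oplus _)
  luk _ _ := congrArg ULift.up (luk _ _)
  smul r x := ⟨RieszMVAlgebra.smul r x.down⟩
  smul_odot_star _ _ _ := congrArg ULift.up (RieszMVAlgebra.smul_odot_star _ _ _)
  odot_star_smul _ _ _ := congrArg ULift.up (RieszMVAlgebra.odot_star_smul _ _ _)
  smul_smul _ _ _ := congrArg ULift.up (RieszMVAlgebra.smul_smul _ _ _)
  one_smul _ := congrArg ULift.up (RieszMVAlgebra.one_smul _)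

theorem IsEvaluation.up {R : Type*} [RieszMVAlgebra R] {e : RForm → R} (he : IsEvaluation e) :
    IsEvaluation fun φ => (ULift.up (e φ) : ULift.{u} R) :=
  ⟨fun φ ψ => congrArg ULift.up (he.map_imp φ ψ), fun φ => congrArg ULift.up (he.map_neg φ),
    fun r φ => congrArg ULift.up (he.map_nabla r φ)⟩

end RieszMV

theorem theorem6p3 :
    (∀ φ : RieszMV.RForm,
      List.TFAE [
        φ.Provable,
        ∀ (R : Type u) [RieszMV.RieszMVAlgebra R] (e : RieszMV.RForm → R),
          RieszMV.IsEvaluation e → e φ = RieszMV.MVAlgebra.one,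
        ∀ e : RieszMV.RForm → unitInterval, RieszMV.IsEvaluation e → e φ = 1]) ∧
    (∀ φ : RieszMV.LForm, φ.Provable ↔ φ.toRForm.Provable) := by
  -- Conservativity passes through the semantics: provability in ℝℒ forces value 1 in $[0,1]$, and
  -- Chang's theorem then applies.
  refine ⟨fun φ => ?_, fun φ => ⟨fun h => h.toRForm, fun h =>
    RieszMV.LForm.provable_of_eval fun v =>
      (h.eval_eq_one (RieszMV.RForm.isEvaluation_eval v)).trans RieszMV.one_eq_one⟩⟩
  tfae_have 1 → 2 := fun h R _ e he => h.eval_eq_one he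
  tfae_have 2 → 3 := fun h e he =>
    (congrArg ULift.down (h (ULift.{u} unitInterval) _ he.up)).trans RieszMV.one_eq_one
  tfae_have 3 → 1 := fun h => RieszMV.RForm.provable_of_eval fun v =>
    h _ (RieszMV.RForm.isEvaluation_eval v)
  tfae_finish
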